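/- Conventions. A valued quiver $(Q,\mathbf d)$ is a finite quiver $Q$ with a positive integer $d_i$ at each vertex $i$. For a finite field $\mathbb F$ with $q$ elements let $\mathbb F_a$ be the extension of degree $a$ in a fixed algebraic closure. A representation $V$ assigns to each vertex $i$ a finite-dimensional $\mathbb F_{d_i}$-space $V_i$ and to each arrow $\alpha:i\to j$ an $\mathbb F_{\gcd(d_i,d_j)}$-linear map $V_i\to V_j$; these form an abelian category $\operatorname{rep}_{\mathbb F}(Q,\mathbf d)$. Let $S_i$ be the simple representation at $i$, $\mathbb F_i=\operatorname{End}(S_i)$, and $|V|=\sum_i\dim_{\mathbb F_{d_i}}(V_i)\,|S_i|$ the class of $V$ in the Grothendieck group $\mathcal K(Q)=\bigoplus_i\mathbb Z|S_i|$. Fix a field $\Bbbk$ of characteristic $0$ and $v\in\Bbbk^\times$ with $v^4=q$, write $q^{c}=v^{4c}$ for $c\in\frac14\mathbb Z$, and put $\langle V,W\rangle=\prod_{k\ge0}|\operatorname{Ext}^k(V,W)|^{\frac12(-1)^k}$. Let $a_{ii}=2$ and $a_{ij}=-\dim_{\mathbb F_i}\operatorname{Ext}^1(S_i,S_j)-\dim_{\mathbb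 F_i}\operatorname{Ext}^1(S_j,S_i)$ for $i\ne j$ (the Cartan matrix), and for a quiver without loops and two-cycles let $b_{ij}=\dim_{\mathbb F_i}\operatorname{Ext}^1(S_i,S_j)$ if this is nonzero, and $b_{ij}=-\dim_{\mathbb F_i}\operatorname{Ext}^1(S_j,S_i)$ otherwise. Define endomorphisms of $\mathcal K(Q)$ by ${}^*|S_j|=|S_j|-\sum_k[b_{kj}]_+|S_k|$ and $|S_j|^*=|S_j|-\sum_k[-b_{kj}]_+|S_k|$, where $[b]_+=\max(b,0)$, and put $\mathbf b^j=|S_j|^*-{}^*|S_j|$. A bicharacter $\chi:L\times L\to\Bbbk^\times$ of a lattice $L$ is unitary if $\chi(e,e)=1$ and $\chi(e,f)\chi(f,e)=1$ for all $e,f$; then $\mathcal T_\chi$ is the $\Bbbk$-algebra with basis $X^e$ ($e\in L$) and $X^eX^f=\chi(e,f)X^{e+f}$. For a sequence $\mathbf i=(i_1,\dots,i_m)$ of vertices let $P_{\mathbf i}$ be generated by $t_1,\dots,t_m$ with $t_\ell t_k=\langle S_{i_k},S_{i_\ell}\rangle\langle S_{i_\ell},S_{i_k}\rangle\,t_kt_\ell$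 for $k<\ell$, and let $\mathcal L_{\mathbf i}=P_{\mathbf i}[t_1^{-1},\dots,t_m^{-1}]$, a based quantum torus on $\mathbb Z^m$ with $t_k=t^{\varepsilon_k}$, whose unitary bicharacter takes the value $(\langle S_{i_k},S_{i_\ell}\rangle\langle S_{i_\ell},S_{i_k}\rangle)^{1/2}$ at $(\varepsilon_\ell,\varepsilon_k)$ for $k<\ell$. The $\mathbf i$-character of $V$ is $$X_{V,\mathbf i}=\sum_{\mathbf a\in\mathbb Z_{\ge0}^m}\ \prod_{k<\ell}\Big(\tfrac{\langle S_{i_k},S_{i_\ell}\rangle}{\langle S_{i_\ell},S_{i_k}\rangle}\Big)^{\frac12a_ka_\ell}\,|\mathcal F_{\mathbf i,\mathbf a}(V)|\;t_1^{a_1}\cdots t_m^{a_m},$$ where $\mathcal F_{\mathbf i,\mathbf a}(V)$ is the set of flags of subobjects $0=V_m\subset\cdots\subset V_1\subset V_0=V$ with $V_{k-1}/V_k\cong S_{i_k}^{\oplus a_k}$ for all $k$. An isomorphism $\psi:\mathbb Z^m\to L$ of lattices extends to an isomorphism $\hat\psi:\mathcal L_{\mathbf i}\to\mathcal T_{\chi_{\mathbf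 i,\psi}}$, $t^{\mathbf a}\mapsto X^{\psi(\mathbf a)}$, for a unique unitary bicharacter $\chi_{\mathbf i,\psi}$ of $L$. Let $k^+=\min(\{\ell>k: i_\ell=i_k\}\cup\{m+1\})$, $k^-=\max(\{\ell<k: i_\ell=i_k\}\cup\{0\})$, $\varepsilon_0=0$, and define automorphisms of $\mathbb Z^m$ by $$\varphi_{\mathbf i}(\varepsilon_k)=-\varepsilon_k-\varepsilon_{k^-}-\sum_{\ell<k<\ell^+}a_{i_\ell i_k}\varepsilon_\ell,\qquad \rho_{\mathbf i}(\varepsilon_k)=\varepsilon_k-\sum_{\ell\le k,\ \ell^+=m+1}a_{i_\ell i_k}\varepsilon_\ell .$$ Theorem. Let $(Q,\mathbf d)$ be an acyclic valued quiver with $n$ vertices, and let $\mathbf i_0=(i_1,\dots,i_n)$ be a source-adapted sequence containing every vertex exactly once, i.e. $i_k$ is a source of $\mu_{i_{k-1}}\cdots\mu_{i_1}Q$ for all $k$, where $\mu_i$ reverses all arrows at $i$. Put $\mathbf i=(\mathbf i_0,\mathbf i_0)$. There exists an acyclic valued quiver $(\tilde Q,\tilde{\mathbf d})$ on $2n$ vertices,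 containing $(Q,\mathbf d)$ as the full valued subquiver on $n$ of its vertices, such that the following holds for every finite field $\mathbb F$ and all $\Bbbk$, $v$ as above. Identify $\mathbb Z^{2n}$ with $\mathcal K(\tilde Q)$ by sending $\varepsilon_k$ to $|S_{i_k}|$ and $\varepsilon_{n+k}$ to the class of the simple at the $k$-th additional vertex ($1\le k\le n$), and let $\psi=\rho_{\mathbf i}^{-1}\varphi_{\mathbf i}:\mathbb Z^{2n}\to\mathcal K(\tilde Q)$. (a) $\mathcal T_{\chi_{\mathbf i,\psi}}$ is a based quantum torus attached to $\tilde Q$ with the vertices of $Q$ as exchangeable vertices, that is, $\chi=\chi_{\mathbf i,\psi}$ satisfies $\chi(\mathbf b^j,|S_i|)=|\mathbb F_i|^{\frac12\delta_{ij}}$ for every vertex $j$ of $Q$ and every vertex $i$ of $\tilde Q$ (with $\mathbf b^j$, $S_i$, $\mathbb F_i$ taken in $\operatorname{rep}_{\mathbb F}(\tilde Q,\tilde{\mathbf d})$). (b) For every $V\in\operatorname{rep}_{\mathbb F}(Q,\mathbf d)$ one has $\hat\psi(X_{V,\mathbf i})=\tilde X_V$ in $\mathcal T_{\chi_{\mathbf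 i,\psi}}$, where $$\tilde X_V=\sum_{E\subset V}\langle E,V/E\rangle^{-1}\,X^{-|E|^*-{}^*|V/E|}$$ is the quantum cluster character of $V$, regarded as an object of $\operatorname{rep}_{\mathbb F}(\tilde Q,\tilde{\mathbf d})$ that vanishes at the additional vertices. -/

import Mathlib

open CategoryTheory CategoryTheory.Limits

universe u w

noncomputable section

namespace QuantumCharacter

/-! ### Valued quivers -/

/-- A finite quiver with vertex set `I`, together with a positive integer `d i` attached to each
vertex `i`. -/
structure ValuedQuiver (I : Type) where
  Arrow : Type
  finite_arrow : Finite Arrow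
  s : Arrow → I
  t : Arrow → I
  d : I → ℕ
  d_pos : ∀ i, 0 < d i

namespace ValuedQuiver

variable {I : Type}

/-- No oriented cycles (in particular no loops). -/
def Acyclic (Q : ValuedQuiver I) : Prop :=
  ∀ i, ¬ Relation.TransGen (fun a b => ∃ α : Q.Arrow, Q.s α = a ∧ Q.t α = b) i i

/-- No arrow ends at `i`. -/
def IsSource (Q : ValuedQuiver I) (i : I) : Prop := ∀ α : Q.Arrow, Q.t α ≠ i

open Classical in
/-- The quiver `μ_i Q`, obtained by reversing all arrows that start or end at `i`. -/
def reflect (Q : ValuedQuiver I) (i : I) : ValuedQuiver I where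
  Arrow := Q.Arrow
  finite_arrow := Q.finite_arrow
  s α := if Q.s α = i ∨ Q.t α = i then Q.t α else Q.s α
  t α := if Q.s α = i ∨ Q.t α = i then Q.s α else Q.t α
  d := Q.d
  d_pos := Q.d_pos

/-- `(i₁, i₂, …)` is source adapted: `i_k` is a source of `μ_{i_{k-1}} ⋯ μ_{i_1} Q` for all `k`. -/
def SourceAdapted : ValuedQuiver I → List I → Prop
  | _, [] => True
  | Q, i :: l => Q.IsSource i ∧ SourceAdapted (Q.reflect i) l

/-- The data of an extension of `Q` by further vertices `J`: valuations of the new vertices and a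
finite set of new arrows, none of which joins two vertices of `Q`. -/
structure Extension (Q : ValuedQuiver I) (J : Type) where
  d' : J → ℕ
  d'_pos : ∀ j, 0 < d' j
  NewArrow : Type
  finite_newArrow : Finite NewArrow
  s' : NewArrow → I ⊕ J
  t' : NewArrow → I ⊕ J
  not_both : ∀ α, ¬ ((s' α).isLeft = true ∧ (t' α).isLeft = true)

/-- The extended valued quiver; its full valued subquiver on the vertices `I` is `Q`. -/
def Extension.quiver {Q : ValuedQuiver I} {J : Type} (X : Q.Extension J) :
    ValuedQuiver (I ⊕ J) where
  Arrow := Q.Arrow ⊕ X.NewArrow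
  finite_arrow := by
    have := Q.finite_arrow
    have := X.finite_newArrow
    infer_instance
  s := Sum.elim (fun α => Sum.inl (Q.s α)) X.s'
  t := Sum.elim (fun α => Sum.inl (Q.t α)) X.t'
  d := Sum.elim Q.d X.d'
  d_pos := by
    rintro (i | j)
    · exact Q.d_pos i
    · exact X.d'_pos j

end ValuedQuiver

/-! ### Finite extensions of a finite field -/

/-- The extension of degree `a` of a finite field `F` with `q` elements inside the algebraic
closure of `F` (for `a ≥ 1`): the solutions of `x ^ (q ^ a) = x`. -/
def extField (F : Type u) [Field F] [Finite F] (a : ℕ) : IntermediateField F (AlgebraicClosure F) :=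
  letI := Fintype.ofFinite F
  let σ : AlgebraicClosure F →ₐ[F] AlgebraicClosure F :=
    FiniteField.frobeniusAlgHom F (AlgebraicClosure F) ^ a
  have hσ : ∀ x, σ x = x ^ (Nat.card F ^ a) := fun x => by
    simp only [σ]
    rw [AlgHom.coe_pow, FiniteField.coe_frobeniusAlgHom, pow_iterate, Nat.card_eq_fintype_card]
  { carrier := {x | x ^ (Nat.card F ^ a) = x}
    mul_mem' := fun {x y} hx hy => by
      simp only [Set.mem_ofPred_eq, ← hσ] at *
      rw [map_mul, hx, hy]
    add_mem' := fun {x y} hx hy => by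
      simp only [Set.mem_ofPred_eq, ← hσ] at *
      rw [map_add, hx, hy]
    algebraMap_mem' := fun r => by
      simp only [Set.mem_ofPred_eq, ← hσ]
      exact σ.commutes r
    inv_mem' := fun x hx => by
      simp only [Set.mem_ofPred_eq, ← hσ] at *
      rw [map_inv₀, hx] }

theorem mem_extField {F : Type u} [Field F] [Finite F] {a : ℕ} {x : AlgebraicClosure F} :
    x ∈ extField F a ↔ x ^ (Nat.card F ^ a) = x := Iff.rfl

theorem extField_le {F : Type u} [Field F] [Finite F] {a b : ℕ} (h : a ∣ b) :
    extField F a ≤ extField F b := by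
  intro x hx
  rw [mem_extField] at *
  obtain ⟨c, rfl⟩ := h
  induction c with
  | zero => simp
  | succ n ih => rw [Nat.mul_succ, pow_add, pow_mul, ih, hx]

/-! ### Representations of valued quivers -/

variable (F : Type u) [Field F] [Finite F] {I : Type}

/-- The field attached to the vertex `i`. -/
abbrev VertexField (Q : ValuedQuiver I) (i : I) : Type u := ↥(extField F (Q.d i))

/-- The field over which the map attached to the arrow `α` has to be linear. -/
abbrev ArrowField (Q : ValuedQuiver I) (α : Q.Arrow) : Type u :=
  ↥(extField F (Nat.gcd (Q.d (Q.s α)) (Q.d (Q.t α))))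

/-- The inclusion of the field of an arrow into the field of its source. -/
def inclS (Q : ValuedQuiver I) (α : Q.Arrow) : ArrowField F Q α →+* VertexField F Q (Q.s α) :=
  (IntermediateField.inclusion (extField_le (Nat.gcd_dvd_left _ _))).toRingHom

/-- The inclusion of the field of an arrow into the field of its target. -/
def inclT (Q : ValuedQuiver I) (α : Q.Arrow) : ArrowField F Q α →+* VertexField F Q (Q.t α) :=
  (IntermediateField.inclusion (extField_le (Nat.gcd_dvd_right _ _))).toRingHom

/-- Finite dimensional representations of the valued quiver `Q` over the finite field `F`. -/
structure Rep (Q : ValuedQuiver I) where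
  V : I → Type u
  [addCommGroup : ∀ i, AddCommGroup (V i)]
  [module : ∀ i, Module (VertexField F Q i) (V i)]
  [finite : ∀ i, Module.Finite (VertexField F Q i) (V i)]
  map : ∀ α : Q.Arrow, V (Q.s α) →+ V (Q.t α)
  map_smul : ∀ (α : Q.Arrow) (c : ArrowField F Q α) (x : V (Q.s α)),
    map α (inclS F Q α c • x) = inclT F Q α c • map α x

attribute [instance] Rep.addCommGroup Rep.module Rep.finite

variable {F} {Q : ValuedQuiver I}

namespace Rep

/-- Morphisms of representations. -/
@[ext]
structure Hom (V W : Rep F Q) where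
  app : ∀ i, V.V i →ₗ[VertexField F Q i] W.V i
  comm : ∀ (α : Q.Arrow) (x : V.V (Q.s α)), W.map α (app _ x) = app _ (V.map α x)

instance : Category (Rep F Q) where
  Hom := Hom
  id V := ⟨fun _ => LinearMap.id, fun _ _ => rfl⟩
  comp f g := ⟨fun i => (g.app i).comp (f.app i), fun α x => by simp [f.comm, g.comm]⟩

@[ext]
theorem hom_ext {V W : Rep F Q} {f g : V ⟶ W} (h : ∀ i x, f.app i x = g.app i x) : f = g :=
  Hom.ext (funext fun i => LinearMap.ext (h i))

@[simp] theorem id_app (V : Rep F Q) (i : I) : Hom.app (𝟙 V) i = LinearMap.id := rfl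

@[simp] theorem comp_app {U V W : Rep F Q} (f : U ⟶ V) (g : V ⟶ W) (i : I) :
    (f ≫ g).app i = (g.app i).comp (f.app i) := rfl

section Additive

variable {V W : Rep F Q}

instance : Zero (V ⟶ W) := ⟨⟨fun _ => 0, fun _ _ => by simp⟩⟩
instance : Add (V ⟶ W) :=
  ⟨fun f g => ⟨fun i => f.app i + g.app i, fun α x => by simp [f.comm, g.comm]⟩⟩
instance : Neg (V ⟶ W) := ⟨fun f => ⟨fun i => - f.app i, fun α x => by simp [f.comm]⟩⟩

@[simp] theorem zero_app (i : I) : Hom.app (0 : V ⟶ W) i = 0 := rfl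
@[simp] theorem add_app (f g : V ⟶ W) (i : I) : (f + g).app i = f.app i + g.app i := rfl
@[simp] theorem neg_app (f : V ⟶ W) (i : I) : (-f).app i = - f.app i := rfl

instance : AddCommGroup (V ⟶ W) where
  add_assoc f g h := by ext; simp [add_assoc]
  zero_add f := by ext; simp
  add_zero f := by ext; simp
  add_comm f g := by ext; simp [add_comm]
  neg_add_cancel f := by ext; simp
  nsmul := nsmulRec
  zsmul := zsmulRec

end Additive

instance : Preadditive (Rep F Q) where
  add_comp := by intros; ext; simp
  comp_add := by intros; ext; simp

/-- The direct sum `V ⊕ W`. -/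
def prod (V W : Rep F Q) : Rep F Q where
  V i := V.V i × W.V i
  map α := (V.map α).prodMap (W.map α)
  map_smul α c x := by ext <;> simp [V.map_smul, W.map_smul]

/-- The direct sum `V ⊕ ⋯ ⊕ V` of `a` copies of `V`. -/
def pow (V : Rep F Q) (a : ℕ) : Rep F Q where
  V i := Fin a → V.V i
  map α := (V.map α).compLeft (Fin a)
  map_smul α c x := by ext k; simp [V.map_smul]

/-- The zero representation. -/
def zeroRep : Rep F Q where
  V _ := PUnit
  map _ := 0
  map_smul _ _ _ := by simp

instance : HasZeroObject (Rep F Q) :=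
  ⟨zeroRep, ⟨fun _ => ⟨⟨⟨0⟩, fun f => by
    ext i x
    rw [show x = 0 from Subsingleton.elim (α := PUnit) _ _, map_zero, map_zero]⟩⟩,
    fun _ => ⟨⟨⟨0⟩, fun f => by ext i x; exact Subsingleton.elim (α := PUnit) _ _⟩⟩⟩⟩

instance : HasBinaryBiproducts (Rep F Q) where
  has_binary_biproduct V W := by
    let b : BinaryBicone V W :=
      { pt := prod V W
        fst := ⟨fun i => LinearMap.fst _ _ _, fun _ _ => rfl⟩
        snd := ⟨fun i => LinearMap.snd _ _ _, fun _ _ => rfl⟩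
        inl := ⟨fun i => LinearMap.inl _ _ _, fun α x => Prod.ext rfl (map_zero (W.map α))⟩
        inr := ⟨fun i => LinearMap.inr _ _ _, fun α x => Prod.ext (map_zero (V.map α)) rfl⟩
        inl_fst := rfl
        inl_snd := rfl
        inr_fst := rfl
        inr_snd := rfl }
    refine HasBinaryBiproduct.mk ⟨b, isBinaryBilimitOfTotal b ?_⟩
    ext i x
    exact Prod.ext (add_zero x.1) (zero_add x.2)

instance : HasFiniteProducts (Rep F Q) :=
  hasFiniteProducts_of_has_binary_and_terminal

end Rep

/-- Subobjects of a representation: subspaces at all vertices, stable under the maps of all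
arrows. -/
@[ext]
structure SubRep (V : Rep F Q) where
  carrier : ∀ i, Submodule (VertexField F Q i) (V.V i)
  stable : ∀ (α : Q.Arrow) (x : V.V (Q.s α)), x ∈ carrier (Q.s α) → V.map α x ∈ carrier (Q.t α)

namespace SubRep

variable {V : Rep F Q}

instance : LE (SubRep V) := ⟨fun E E' => ∀ i, E.carrier i ≤ E'.carrier i⟩
instance : Top (SubRep V) := ⟨⟨fun _ => ⊤, fun _ _ _ => trivial⟩⟩
instance : Bot (SubRep V) := ⟨⟨fun _ => ⊥, fun α x hx => by
  rw [Submodule.mem_bot] at *; rw [hx, map_zero]⟩⟩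

/-- A subobject, viewed as a representation. -/
def toRep (E : SubRep V) : Rep F Q where
  V i := ↥(E.carrier i)
  map α := ((V.map α).comp (E.carrier (Q.s α)).toAddSubgroup.subtype).codRestrict
    (E.carrier (Q.t α)).toAddSubgroup (fun x => E.stable α x.1 x.2)
  map_smul α c x := Subtype.ext (V.map_smul α c x.1)

/-- The quotient representation `V / E`. -/
def quotient (E : SubRep V) : Rep F Q where
  V i := V.V i ⧸ E.carrier i
  map α := QuotientAddGroup.map (E.carrier (Q.s α)).toAddSubgroup
    (E.carrier (Q.t α)).toAddSubgroup (V.map α) (fun x hx => E.stable α x hx)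
  map_smul α c x := by
    induction x using Submodule.Quotient.induction_on with
    | H x => exact congrArg _ (V.map_smul α c x)

/-- The intersection `E ∩ E'`, viewed as a subobject of `E'` (it is `E` if `E ⊆ E'`). -/
def restrict (E E' : SubRep V) : SubRep E'.toRep where
  carrier i := (E.carrier i).comap (E'.carrier i).subtype
  stable α x hx := E.stable α x.1 hx

/-- The inclusion. -/
def ι (E : SubRep V) : E.toRep ⟶ V := ⟨fun i => (E.carrier i).subtype, fun _ _ => rfl⟩

/-- The projection. -/
def π (E : SubRep V) : V ⟶ E.quotient := ⟨fun i => (E.carrier i).mkQ, fun _ _ => rfl⟩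

end SubRep

namespace Rep

variable {V W : Rep F Q}

/-- The kernel. -/
def ker (f : V ⟶ W) : SubRep V where
  carrier i := LinearMap.ker (f.app i)
  stable α x hx := by
    rw [LinearMap.mem_ker] at *
    rw [← f.comm, hx, map_zero]

/-- The image. -/
def range (f : V ⟶ W) : SubRep W where
  carrier i := LinearMap.range (f.app i)
  stable α x hx := by
    obtain ⟨y, rfl⟩ := hx
    exact ⟨V.map α y, (f.comm α y).symm⟩

theorem ker_ι (f : V ⟶ W) : (ker f).ι ≫ f = 0 := by
  ext i x
  exact x.2

theorem range_π (f : V ⟶ W) : f ≫ (range f).π = 0 := by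
  ext i x
  exact (Submodule.Quotient.mk_eq_zero _).2 ⟨x, rfl⟩

theorem app_injective (f : V ⟶ W) [Mono f] (i : I) : Function.Injective (f.app i) := by
  have h : (ker f).ι = 0 := by
    rw [← cancel_mono f, ker_ι, zero_comp]
  rw [← LinearMap.ker_eq_bot, eq_bot_iff]
  intro x hx
  exact congrArg (fun g : (ker f).toRep ⟶ V => g.app i ⟨x, hx⟩) h

theorem app_surjective (f : V ⟶ W) [Epi f] (i : I) : Function.Surjective (f.app i) := by
  have h : (range f).π = 0 := by
    rw [← cancel_epi f, range_π, comp_zero]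
  intro x
  have := congrArg (fun g : W ⟶ (range f).quotient => g.app i x) h
  exact (Submodule.Quotient.mk_eq_zero _).1 this

instance : HasKernels (Rep F Q) where
  has_limit {V W} f := by
    refine ⟨⟨⟨_, KernelFork.IsLimit.ofι (ker f).ι (ker_ι f) (fun {Z} g hg => ⟨fun i =>
      (g.app i).codRestrict _ (fun x => congrArg (fun h : Z ⟶ W => h.app i x) hg),
      fun α x => Subtype.ext (g.comm α x)⟩) (fun g hg => rfl) ?_⟩⟩⟩
    intro Z g hg m hm
    ext i x
    exact Subtype.ext (congrArg (fun h : Z ⟶ V => h.app i x) hm)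

instance : HasCokernels (Rep F Q) where
  has_colimit {V W} f := by
    refine ⟨⟨⟨_, CokernelCofork.IsColimit.ofπ (range f).π (range_π f) (fun {Z} g hg => ⟨fun i =>
      (LinearMap.range (f.app i)).liftQ (g.app i) (by
        rintro _ ⟨x, rfl⟩
        exact congrArg (fun h : V ⟶ Z => h.app i x) hg),
      fun α x => by
        induction x using Submodule.Quotient.induction_on with
        | H x => exact g.comm α x⟩) (fun g hg => rfl) ?_⟩⟩⟩
    intro Z g hg m hm
    ext i x
    induction x using Submodule.Quotient.induction_on with
    | H x => exact congrArg (fun h : W ⟶ Z => h.app i x) hm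

/-- The category of representations of a valued quiver is abelian. -/
instance : Abelian (Rep F Q) where
  normalMonoOfMono {V W} f hf := by
    have hinj := app_injective f
    have key : ∀ {Z : Rep F Q} (g : Z ⟶ W), g ≫ (range f).π = 0 → ∀ i x,
        g.app i x ∈ LinearMap.range (f.app i) := fun {Z} g hg i x =>
      (Submodule.Quotient.mk_eq_zero _).1
        (congrArg (fun h : Z ⟶ (range f).quotient => h.app i x) hg)
    have lift : ∀ {Z : Rep F Q} (g : Z ⟶ W), g ≫ (range f).π = 0 →
        ∃ l : Z ⟶ V, l ≫ f = g := by
      intro Z g hg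
      let l : ∀ i, Z.V i →ₗ[VertexField F Q i] V.V i := fun i =>
        (LinearEquiv.ofInjective (f.app i) (hinj i)).symm.toLinearMap.comp
          ((g.app i).codRestrict _ (key g hg i))
      have hl : ∀ i x, f.app i (l i x) = g.app i x := fun i x =>
        congrArg Subtype.val ((LinearEquiv.ofInjective (f.app i) (hinj i)).apply_symm_apply
          ⟨g.app i x, key g hg i x⟩)
      refine ⟨⟨l, fun α x => hinj _ ?_⟩, ?_⟩
      · rw [← f.comm, hl, hl, g.comm]
      · ext i x
        exact hl i x
    choose l hl using @lift
    exact ⟨⟨_, (range f).π, range_π f, KernelFork.IsLimit.ofι f (range_π f) l hl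
      (fun g hg m hm => by rw [← cancel_mono f, hm, hl])⟩⟩
  normalEpiOfEpi {V W} f hf := by
    have hsurj := app_surjective f
    have desc : ∀ {Z : Rep F Q} (g : V ⟶ Z), (ker f).ι ≫ g = 0 →
        ∃ l : W ⟶ Z, f ≫ l = g := by
      intro Z g hg
      have key : ∀ i, LinearMap.ker (f.app i) ≤ LinearMap.ker (g.app i) := fun i x hx =>
        congrArg (fun h : (ker f).toRep ⟶ Z => h.app i ⟨x, hx⟩) hg
      let l : ∀ i, W.V i →ₗ[VertexField F Q i] Z.V i := fun i =>
        ((LinearMap.ker (f.app i)).liftQ (g.app i) (key i)).comp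
          ((f.app i).quotKerEquivOfSurjective (hsurj i)).symm.toLinearMap
      have hl : ∀ i x, l i (f.app i x) = g.app i x := fun i x => by
        have : ((f.app i).quotKerEquivOfSurjective (hsurj i)).symm (f.app i x)
            = Submodule.Quotient.mk x := by
          rw [LinearEquiv.symm_apply_eq]; rfl
        simp [l, this]
      refine ⟨⟨l, fun α x => ?_⟩, ?_⟩
      · obtain ⟨y, rfl⟩ := hsurj _ x
        rw [f.comm, hl, hl, g.comm]
      · ext i x
        exact hl i x
    choose l hl using @desc
    exact ⟨⟨_, (ker f).ι, ker_ι f, CokernelCofork.IsColimit.ofπ f (ker_ι f) l hl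
      (fun g hg m hm => by rw [← cancel_epi f, hm, hl])⟩⟩

instance : HasExt.{u + 1} (Rep F Q) := HasExt.standard _

end Rep

/-! ### Dimension vectors, simple representations, Euler form -/

/-- The class `|V|` of `V` in the Grothendieck group, identified with `ℤ^I` through the classes of
the simple representations attached to the vertices. -/
def Rep.dim (V : Rep F Q) : I → ℤ := fun i => Module.finrank (VertexField F Q i) (V.V i)

variable (F Q) in
/-- The simple representation `S_i`: the field of the vertex `i` at `i`, and `0` at the other
vertices (functions on an empty type). -/
def simple (i : I) : Rep F Q where
  V j := PLift (j = i) → VertexField F Q j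
  map _ := 0
  map_smul _ _ _ := by
    rw [AddMonoidHom.zero_apply, AddMonoidHom.zero_apply]
    exact (smul_zero _).symm

/-- The exponent `∑ₙ (-1)ⁿ log_q |Extⁿ(V, W)|`. -/
def eulerExponent (V W : Rep F Q) : ℤ :=
  ∑ᶠ n : ℕ, (-1) ^ n * (Nat.log (Nat.card F) (Nat.card (Abelian.Ext V W n)) : ℤ)

section Ringel

variable {𝕜 : Type*} [Field 𝕜] (v : 𝕜ˣ)

/-- `⟨V, W⟩ = ∏ₙ |Extⁿ(V, W)| ^ ((-1)ⁿ / 2)`, where `v` is a chosen fourth root of `q`. -/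
def ringel (V W : Rep F Q) : 𝕜ˣ := v ^ (2 * eulerExponent V W)

/-- `⟨V, W⟩ ^ (1/2)`. -/
def sqrtRingel (V W : Rep F Q) : 𝕜ˣ := v ^ eulerExponent V W

theorem sqrtRingel_sq (V W : Rep F Q) : sqrtRingel v V W ^ 2 = ringel v V W := by
  rw [sqrtRingel, ringel, ← zpow_natCast, ← zpow_mul, mul_comm]
  rfl

end Ringel

variable (F Q) in
/-- The dimension over the finite field `End(S_i)` of an `End(S_i)`-vector space `M`, as the
logarithm of the cardinality of `M` to the base `|End(S_i)|`. -/
def dimOverEnd (i : I) (M : Type*) : ℕ := Nat.log (Nat.card (simple F Q i ⟶ simple F Q i)) (Nat.card M)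

variable (F Q) in
/-- `Ext¹(S_i, S_j)`. -/
abbrev ExtSimple (i j : I) : Type (u + 1) := Abelian.Ext (simple F Q i) (simple F Q j) 1

open Classical in
variable (F Q) in
/-- The Cartan matrix: `a_ii = 2`, and
`a_ij = - dim Ext¹(S_i, S_j) - dim Ext¹(S_j, S_i)` over `End(S_i)` for `i ≠ j`. -/
def cartan (i j : I) : ℤ :=
  if i = j then 2
  else - (dimOverEnd F Q i (ExtSimple F Q i j) : ℤ) - (dimOverEnd F Q i (ExtSimple F Q j i) : ℤ)

open Classical in
variable (F Q) in
/-- The exchange matrix `B = (b_ij)`. -/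
def exchange (i j : I) : ℤ :=
  if Nontrivial (ExtSimple F Q i j) then (dimOverEnd F Q i (ExtSimple F Q i j) : ℤ)
  else if Nontrivial (ExtSimple F Q j i) then - (dimOverEnd F Q i (ExtSimple F Q j i) : ℤ)
  else 0

variable (F Q) in
/-- `*e`, where `*|S_j| = |S_j| - ∑ₖ [b_kj]₊ |S_k|`. -/
def leftStar [Fintype I] (e : I → ℤ) : I → ℤ :=
  fun k => e k - ∑ j, max (exchange F Q k j) 0 * e j

variable (F Q) in
/-- `e*`, where `|S_j|* = |S_j| - ∑ₖ [-b_kj]₊ |S_k|`. -/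
def rightStar [Fintype I] (e : I → ℤ) : I → ℤ :=
  fun k => e k - ∑ j, max (- exchange F Q k j) 0 * e j

/-! ### Based quantum tori -/

/-- Unitary bicharacters `L × L → 𝕜ˣ`. -/
structure UnitaryBichar (L : Type*) [AddCommGroup L] (𝕜 : Type*) [Field 𝕜] where
  toFun : L → L → 𝕜ˣ
  add_left : ∀ e e' f, toFun (e + e') f = toFun e f * toFun e' f
  add_right : ∀ e f f', toFun e (f + f') = toFun e f * toFun e f'
  self : ∀ e, toFun e e = 1
  swap : ∀ e f, toFun e f * toFun f e = 1

instance {L : Type*} [AddCommGroup L] {𝕜 : Type*} [Field 𝕜] :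
    CoeFun (UnitaryBichar L 𝕜) (fun _ => L → L → 𝕜ˣ) := ⟨UnitaryBichar.toFun⟩

section Torus

variable {L : Type*} [AddCommGroup L] {L' : Type*} [AddCommGroup L'] {𝕜 : Type*} [Field 𝕜]

namespace UnitaryBichar

theorem zero_left (χ : UnitaryBichar L 𝕜) (f : L) : χ 0 f = 1 := by
  have := χ.add_left 0 0 f
  rw [add_zero] at this
  exact left_eq_mul.1 this

theorem zero_right (χ : UnitaryBichar L 𝕜) (e : L) : χ e 0 = 1 := by
  have := χ.add_right e 0 0
  rw [add_zero] at this
  exact left_eq_mul.1 this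

/-- Transport of a bicharacter along an isomorphism of lattices. -/
def map (χ : UnitaryBichar L 𝕜) (ψ : L ≃+ L') : UnitaryBichar L' 𝕜 where
  toFun e f := χ (ψ.symm e) (ψ.symm f)
  add_left e e' f := by rw [map_add, χ.add_left]
  add_right e f f' := by rw [map_add, χ.add_right]
  self e := χ.self _
  swap e f := χ.swap _ _

end UnitaryBichar

/-- The based quantum torus with basis `X^e`, `e ∈ L`, and multiplication
`X^e X^f = χ(e, f) X^(e + f)`. -/
def QTorus (_χ : UnitaryBichar L 𝕜) : Type _ := L →₀ 𝕜

namespace QTorus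

variable (χ : UnitaryBichar L 𝕜)

instance : AddCommGroup (QTorus χ) := inferInstanceAs (AddCommGroup (L →₀ 𝕜))
instance : Module 𝕜 (QTorus χ) := inferInstanceAs (Module 𝕜 (L →₀ 𝕜))

/-- The basis vector `X^e`. -/
def X (e : L) : QTorus χ := Finsupp.single e 1

/-- The basis `X^e`, `e ∈ L`. -/
def basis : Module.Basis L 𝕜 (QTorus χ) := Module.Basis.ofRepr (LinearEquiv.refl 𝕜 (L →₀ 𝕜))

theorem basis_apply (e : L) : basis χ e = X χ e := rfl

/-- The multiplication, as a bilinear map. -/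
def mulBilin : QTorus χ →ₗ[𝕜] QTorus χ →ₗ[𝕜] QTorus χ :=
  (basis χ).constr 𝕜 fun e => (basis χ).constr 𝕜 fun f => (χ e f : 𝕜) • X χ (e + f)

instance : Mul (QTorus χ) := ⟨fun x y => mulBilin χ x y⟩
instance : One (QTorus χ) := ⟨X χ 0⟩

theorem mul_def (x y : QTorus χ) : x * y = mulBilin χ x y := rfl
theorem one_def : (1 : QTorus χ) = X χ 0 := rfl

theorem X_mul_X (e f : L) : X χ e * X χ f = (χ e f : 𝕜) • X χ (e + f) := by
  rw [mul_def, mulBilin, ← basis_apply χ e, Module.Basis.constr_basis, ← basis_apply χ f,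
    Module.Basis.constr_basis]

theorem smul_mul (c : 𝕜) (x y : QTorus χ) : (c • x) * y = c • (x * y) := by simp [mul_def]
theorem mul_smul' (c : 𝕜) (x y : QTorus χ) : x * (c • y) = c • (x * y) := by simp [mul_def]

/-- Additive maps on the torus are determined on the multiples of the basis vectors. -/
theorem induction {p : QTorus χ → Prop} (x : QTorus χ) (zero : p 0)
    (add : ∀ x y, p x → p y → p (x + y)) (smul_X : ∀ (c : 𝕜) e, p (c • X χ e)) : p x := by
  refine Finsupp.induction_linear (motive := p) x zero add fun e c => ?_
  have : (Finsupp.single e c : L →₀ 𝕜) = c • (Finsupp.single e 1 : L →₀ 𝕜) := by simp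
  rw [this]
  exact smul_X c e

theorem add_mul' (x y z : QTorus χ) : (x + y) * z = x * z + y * z := by
  simp only [mul_def, map_add, LinearMap.add_apply]

theorem mul_add' (x y z : QTorus χ) : x * (y + z) = x * y + x * z := map_add _ _ _

theorem zero_mul' (x : QTorus χ) : 0 * x = 0 := by
  simp only [mul_def, map_zero, LinearMap.zero_apply]

theorem mul_zero' (x : QTorus χ) : x * 0 = 0 := map_zero _

theorem mul_assoc' (x y z : QTorus χ) : x * y * z = x * (y * z) := by
  induction x using induction with
  | zero => simp only [zero_mul']
  | add x x' hx hx' => simp only [add_mul', hx, hx']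
  | smul_X a e =>
    induction y using induction with
    | zero => simp only [zero_mul', mul_zero']
    | add y y' hy hy' => simp only [add_mul', mul_add', hy, hy']
    | smul_X b f =>
      induction z using induction with
      | zero => simp only [mul_zero']
      | add z z' hz hz' => simp only [mul_add', hz, hz']
      | smul_X c g =>
        simp only [smul_mul, mul_smul', X_mul_X, χ.add_left, χ.add_right, add_assoc, smul_smul,
          Units.val_mul]
        congr 1
        ring

theorem one_mul' (x : QTorus χ) : 1 * x = x := by
  induction x using induction with
  | zero => exact mul_zero' χ 1
  | add x y hx hy => rw [mul_add', hx, hy]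
  | smul_X c e => rw [mul_smul', one_def, X_mul_X, χ.zero_left, zero_add, Units.val_one, one_smul]

theorem mul_one' (x : QTorus χ) : x * 1 = x := by
  induction x using induction with
  | zero => exact zero_mul' χ 1
  | add x y hx hy => rw [add_mul', hx, hy]
  | smul_X c e => rw [smul_mul, one_def, X_mul_X, χ.zero_right, add_zero, Units.val_one, one_smul]

instance : Ring (QTorus χ) :=
  { (inferInstance : AddCommGroup (QTorus χ)), (inferInstance : Mul (QTorus χ)),
    (inferInstance : One (QTorus χ)) with
    left_distrib := mul_add' χ
    right_distrib := add_mul' χ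
    zero_mul := zero_mul' χ
    mul_zero := mul_zero' χ
    mul_assoc := mul_assoc' χ
    one_mul := one_mul' χ
    mul_one := mul_one' χ }

instance : Algebra 𝕜 (QTorus χ) := Algebra.ofModule (smul_mul χ) (fun c x y => mul_smul' χ c x y)

/-- An isomorphism `ψ` of lattices extends to the isomorphism of based quantum tori
`X^e ↦ X^(ψ e)`. -/
def mapEquiv (ψ : L ≃+ L') : QTorus χ ≃ₐ[𝕜] QTorus (χ.map ψ) :=
  AlgEquiv.ofLinearEquiv (Finsupp.domLCongr ψ.toEquiv : (L →₀ 𝕜) ≃ₗ[𝕜] (L' →₀ 𝕜))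
    (by
      change Finsupp.domLCongr ψ.toEquiv (Finsupp.single 0 1) = _
      rw [Finsupp.domLCongr_single]
      change X (χ.map ψ) (ψ 0) = _
      rw [map_zero]
      rfl)
    (by
      let T : QTorus χ →ₗ[𝕜] QTorus (χ.map ψ) :=
        (Finsupp.domLCongr ψ.toEquiv : (L →₀ 𝕜) ≃ₗ[𝕜] (L' →₀ 𝕜)).toLinearMap
      have hT : ∀ e, T (X χ e) = X (χ.map ψ) (ψ e) := fun e =>
        Finsupp.domLCongr_single ψ.toEquiv e 1
      change ∀ x y, T (x * y) = T x * T y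
      intro x y
      induction x using induction with
      | zero => simp only [zero_mul, map_zero]
      | add x x' hx hx' => simp only [add_mul, map_add, hx, hx']
      | smul_X a e =>
        induction y using induction with
        | zero => simp only [mul_zero, map_zero]
        | add y y' hy hy' => simp only [mul_add, map_add, hy, hy']
        | smul_X b f =>
          simp only [smul_mul, mul_smul', X_mul_X, map_smul, hT, map_add]
          simp [UnitaryBichar.map])

theorem mapEquiv_X (ψ : L ≃+ L') (e : L) : mapEquiv χ ψ (X χ e) = X (χ.map ψ) (ψ e) :=
  Finsupp.domLCongr_single (R := 𝕜) ψ.toEquiv e (1 : 𝕜)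

end QTorus

/-- The unitary bicharacter on `ℤ^m` with `χ(ε_l, ε_k) = c k l = χ(ε_k, ε_l)⁻¹` for `k < l`. -/
def bicharOfTriangular {m : ℕ} (c : Fin m → Fin m → 𝕜ˣ) : UnitaryBichar (Fin m → ℤ) 𝕜 where
  toFun e f := ∏ k, ∏ l ∈ Finset.Ioi k, c k l ^ (e l * f k - e k * f l)
  add_left e e' f := by
    simp only [← Finset.prod_mul_distrib, ← zpow_add]
    refine Finset.prod_congr rfl fun k _ => Finset.prod_congr rfl fun l _ => ?_
    congr 1
    simp only [Pi.add_apply]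
    ring
  add_right e f f' := by
    simp only [← Finset.prod_mul_distrib, ← zpow_add]
    refine Finset.prod_congr rfl fun k _ => Finset.prod_congr rfl fun l _ => ?_
    congr 1
    simp only [Pi.add_apply]
    ring
  self e := by
    refine Finset.prod_eq_one fun k _ => Finset.prod_eq_one fun l _ => ?_
    rw [mul_comm, sub_self, zpow_zero]
  swap e f := by
    simp only [← Finset.prod_mul_distrib, ← zpow_add]
    refine Finset.prod_eq_one fun k _ => Finset.prod_eq_one fun l _ => ?_
    rw [show e l * f k - e k * f l + (f l * e k - f k * e l) = 0 by ring, zpow_zero]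

theorem bicharOfTriangular_single {m : ℕ} (c : Fin m → Fin m → 𝕜ˣ) {k l : Fin m} (h : k < l) :
    bicharOfTriangular c (Pi.single l 1) (Pi.single k 1) = c k l := by
  change (∏ k' : Fin m, ∏ l' ∈ Finset.Ioi k', c k' l' ^ ((Pi.single l 1 : Fin m → ℤ) l' *
    (Pi.single k 1 : Fin m → ℤ) k' - (Pi.single l 1 : Fin m → ℤ) k' *
    (Pi.single k 1 : Fin m → ℤ) l')) = _
  rw [Finset.prod_eq_single k, Finset.prod_eq_single l]
  · simp [h.ne, h.ne']
  · intro l' hl' hne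
    simp [hne, h.ne]
  · intro hl
    exact absurd (Finset.mem_Ioi.2 h) hl
  · intro k' _ hne
    refine Finset.prod_eq_one fun l' hl' => ?_
    have hl' := Finset.mem_Ioi.1 hl'
    by_cases h1 : k' = l
    · have : l' ≠ k := fun h2 => by
        subst h1 h2
        exact absurd h (not_lt.2 hl'.le)
      simp [hne, this]
    · simp [hne, h1]
  · intro hk
    exact absurd (Finset.mem_univ _) hk

end Torus

/-! ### The `𝐢`-character -/

section Character

variable {𝕜 : Type*} [Field 𝕜] (v : 𝕜ˣ) {m : ℕ} (i : Fin m → I)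

variable (F Q) in
/-- The bicharacter of the based quantum torus `ℒ_𝐢 = P_𝐢[t₁⁻¹, …, t_m⁻¹]`. -/
def seqBichar : UnitaryBichar (Fin m → ℤ) 𝕜 :=
  bicharOfTriangular fun k l =>
    sqrtRingel v (simple F Q (i k)) (simple F Q (i l)) *
      sqrtRingel v (simple F Q (i l)) (simple F Q (i k))

variable (F Q) in
/-- The generators `t_k` of `P_𝐢 ⊆ ℒ_𝐢`. -/
def gen (k : Fin m) : QTorus (seqBichar F Q v i) := QTorus.X _ (Pi.single k 1)

variable (F Q) in
/-- The defining relations of `P_𝐢`. -/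
theorem gen_mul_gen {k l : Fin m} (h : k < l) :
    gen F Q v i l * gen F Q v i k =
      ((ringel v (simple F Q (i k)) (simple F Q (i l)) *
        ringel v (simple F Q (i l)) (simple F Q (i k)) : 𝕜ˣ) : 𝕜) •
      (gen F Q v i k * gen F Q v i l) := by
  have h1 := bicharOfTriangular_single (fun k l =>
    sqrtRingel v (simple F Q (i k)) (simple F Q (i l)) *
      sqrtRingel v (simple F Q (i l)) (simple F Q (i k))) h
  have h2 := (seqBichar F Q v i).swap (Pi.single l 1) (Pi.single k 1)
  change seqBichar F Q v i (Pi.single l 1) (Pi.single k 1) = _ at h1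
  simp only [gen, QTorus.X_mul_X, smul_smul]
  rw [add_comm (Pi.single l (1 : ℤ) : Fin m → ℤ) (Pi.single k 1)]
  congr 1
  rw [← Units.val_mul, ← sqrtRingel_sq, ← sqrtRingel_sq, ← mul_pow, ← h1, sq, mul_assoc, h2,
    mul_one]

/-- Flags `0 = V_m ⊆ ⋯ ⊆ V_1 ⊆ V_0 = V` of subobjects with `V_{k-1} / V_k ≅ S_{i_k}^{⊕ a_k}`. -/
def Flags (a : Fin m → ℕ) (V : Rep F Q) : Type u :=
  {W : Fin (m + 1) → SubRep V // W 0 = ⊤ ∧ W (Fin.last m) = ⊥ ∧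
    ∀ k : Fin m, W k.succ ≤ W k.castSucc ∧
      Nonempty (((W k.succ).restrict (W k.castSucc)).quotient ≅ (simple F Q (i k)).pow (a k))}

/-- The `𝐢`-character `X_{V,𝐢}`. -/
def iCharacter (V : Rep F Q) : QTorus (seqBichar F Q v i) :=
  ∑ᶠ a : Fin m → ℕ,
    (((∏ k, ∏ l ∈ Finset.Ioi k,
        (sqrtRingel v (simple F Q (i k)) (simple F Q (i l)) /
          sqrtRingel v (simple F Q (i l)) (simple F Q (i k))) ^ (a k * a l) : 𝕜ˣ) : 𝕜) *
      (Nat.card (Flags i a V) : 𝕜)) •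
    (List.ofFn fun k => gen F Q v i k ^ a k).prod

end Character

/-! ### The monomial change -/

section MonomialChange

variable {m : ℕ} (A : I → I → ℤ) (i : Fin m → I)

/-- `k⁺ = min ({l | l > k, i_l = i_k} ∪ {m})`, for positions numbered `0, …, m - 1`. -/
def next (k : Fin m) : ℕ := sInf ({l | ∃ h : l < m, (k : ℕ) < l ∧ i ⟨l, h⟩ = i k} ∪ {m})

theorem lt_next (k : Fin m) : (k : ℕ) < next i k := by
  have h : next i k ∈ ({l | ∃ h : l < m, (k : ℕ) < l ∧ i ⟨l, h⟩ = i k} ∪ {m} : Set ℕ) :=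
    Nat.sInf_mem ⟨m, Or.inr rfl⟩
  rcases h with ⟨_, h, _⟩ | h
  · exact h
  · rw [show next i k = m from h]
    exact k.2

/-- The matrix of `φ_𝐢(ε_k) = -ε_k - ε_{k⁻} - ∑_{l < k < l⁺} a_{i_l i_k} ε_l`; the entry at `(l, k)`
is the coefficient of `ε_l` in `φ_𝐢(ε_k)`, and `l = k⁻` if and only if `l⁺ = k`. -/
def phiMatrix : Matrix (Fin m) (Fin m) ℤ := fun l k =>
  - (if l = k then 1 else 0) - (if next i l = k then 1 else 0)
    - (if l < k ∧ (k : ℕ) < next i l then A (i l) (i k) else 0)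

/-- The matrix of `ρ_𝐢(ε_k) = ε_k - ∑_{l ≤ k, l⁺ = m + 1} a_{i_l i_k} ε_l` (positions are numbered
from `0` here, so the condition reads `l⁺ = m`). -/
def rhoMatrix : Matrix (Fin m) (Fin m) ℤ := fun l k =>
  (if l = k then 1 else 0) - (if l ≤ k ∧ next i l = m then A (i l) (i k) else 0)

theorem isUnit_det_phiMatrix : IsUnit (phiMatrix A i).det := by
  rw [Matrix.det_of_isUpperTriangular]
  · rw [IsUnit.prod_univ_iff]
    intro k
    have := lt_next i k
    simp [phiMatrix, this.ne']
  · intro l k hkl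
    have hkl : k < l := hkl
    have h1 := lt_next i l
    have h2 : (k : ℕ) < l := hkl
    have h3 : next i l ≠ k := by omega
    simp [phiMatrix, hkl.ne', h3, hkl.le]

theorem isUnit_det_rhoMatrix (hA : ∀ j, A j j = 2) : IsUnit (rhoMatrix A i).det := by
  rw [Matrix.det_of_isUpperTriangular]
  · rw [IsUnit.prod_univ_iff]
    intro k
    by_cases h : next i k = m
    · simp [rhoMatrix, h, hA]
    · simp [rhoMatrix, h]
  · intro l k hkl
    have hkl : k < l := hkl
    simp [rhoMatrix, hkl.ne', hkl]

/-- The automorphism `φ_𝐢` of `ℤ^m`. -/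
def phi : (Fin m → ℤ) ≃ₗ[ℤ] (Fin m → ℤ) :=
  Matrix.toLinearEquiv' (phiMatrix A i)
    (Matrix.invertibleOfIsUnitDet _ (isUnit_det_phiMatrix A i))

/-- The automorphism `ρ_𝐢` of `ℤ^m`. -/
def rho (hA : ∀ j, A j j = 2) : (Fin m → ℤ) ≃ₗ[ℤ] (Fin m → ℤ) :=
  Matrix.toLinearEquiv' (rhoMatrix A i)
    (Matrix.invertibleOfIsUnitDet _ (isUnit_det_rhoMatrix A i hA))

/-- `ρ_𝐢⁻¹ φ_𝐢`. -/
def rhoInvPhi (hA : ∀ j, A j j = 2) : (Fin m → ℤ) ≃ₗ[ℤ] (Fin m → ℤ) :=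
  (phi A i).trans (rho A i hA).symm

end MonomialChange

variable (F Q) in
theorem cartan_self (j : I) : cartan F Q j j = 2 := if_pos rfl

/-- For an ordering `𝐢₀ = (i_1, …, i_n)` of the vertices of a quiver and an extension by `n` further
vertices: the identification of `ℤ^{2n}` with the Grothendieck group of the extended quiver that
sends `ε_k` to `|S_{i_k}|` and `ε_{n+k}` to the class of the simple at the `k`-th new vertex. -/
def relabel {n : ℕ} (i₀ : Fin n ≃ I) : (Fin (n + n) → ℤ) ≃ₗ[ℤ] (I ⊕ Fin n → ℤ) :=
  LinearEquiv.funCongrLeft ℤ ℤ ((Equiv.sumCongr i₀.symm (Equiv.refl (Fin n))).trans finSumFinEquiv)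

variable (F Q) in
/-- The isomorphism `ρ_𝐢⁻¹ φ_𝐢` for `𝐢 = (𝐢₀, 𝐢₀)`, with values in the Grothendieck group of the
extended quiver. -/
def monomialChange {n : ℕ} (i₀ : Fin n ≃ I) : (Fin (n + n) → ℤ) ≃+ (I ⊕ Fin n → ℤ) :=
  ((rhoInvPhi (cartan F Q) (Fin.append i₀ i₀) (cartan_self F Q)).trans (relabel i₀)).toAddEquiv

/-! ### The quantum cluster character -/

section ClusterCharacter

variable [Fintype I] {𝕜 : Type*} [Field 𝕜] (v : 𝕜ˣ)

open Classical in
variable (F Q) in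
/-- `𝐛^j = |S_j|* - *|S_j|`. -/
def bVector (j : I) : I → ℤ :=
  rightStar F Q (Pi.single j 1) - leftStar F Q (Pi.single j 1)

open Classical in
variable (F Q) in
/-- `χ` is a bicharacter defining a based quantum torus attached to `Q` with exchangeable vertices
`ex`: `χ(𝐛^j, |S_i|) = |End(S_i)| ^ (δ_ij / 2)` for all `i ∈ I`, `j ∈ ex`; here
`|End(S_i)| = q ^ a` and `q = v ^ 4`. -/
def IsCompatible (ex : Set I) (χ : UnitaryBichar (I → ℤ) 𝕜) : Prop :=
  ∀ j ∈ ex, ∀ i, χ (bVector F Q j) (Pi.single i 1) =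
    if i = j then v ^ (2 * Nat.log (Nat.card F) (Nat.card (simple F Q i ⟶ simple F Q i))) else 1

/-- The quantum cluster character `X_V = ∑_{E ⊆ V} ⟨E, V/E⟩⁻¹ X^(-|E|* - *|V/E|)`. -/
def clusterCharacter (χ : UnitaryBichar (I → ℤ) 𝕜) (V : Rep F Q) : QTorus χ :=
  ∑ᶠ E : SubRep V, (((ringel v E.toRep E.quotient)⁻¹ : 𝕜ˣ) : 𝕜) •
    QTorus.X χ (- rightStar F Q E.toRep.dim - leftStar F Q E.quotient.dim)

end ClusterCharacter

/-- A representation of `Q`, viewed as a representation of an extended quiver that vanishes at the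
new vertices. -/
def Rep.extendByZero {J : Type} (V : Rep F Q) (X : Q.Extension J) : Rep F X.quiver :=
  letI acg : ∀ i : I ⊕ J, AddCommGroup (Sum.elim V.V (fun _ => PUnit.{u + 1}) i) := fun
    | .inl i => V.addCommGroup i
    | .inr _ => (inferInstance : AddCommGroup PUnit.{u + 1})
  letI mod : ∀ i : I ⊕ J,
      Module (VertexField F X.quiver i) (Sum.elim V.V (fun _ => PUnit.{u + 1}) i) := fun
    | .inl i => V.module i
    | .inr j => (inferInstance : Module (VertexField F X.quiver (.inr j)) PUnit.{u + 1})
  { V := Sum.elim V.V (fun _ => PUnit.{u + 1})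
    addCommGroup := acg
    module := mod
    finite := fun
      | .inl i => V.finite i
      | .inr j => (inferInstance : Module.Finite (VertexField F X.quiver (.inr j)) PUnit.{u + 1})
    map := fun
      | .inl α => V.map α
      | .inr _ => 0
    map_smul := fun
      | .inl α => V.map_smul α
      | .inr α => fun c _ => (@smul_zero _ _ _ (@DistribSMul.toSMulZeroClass _ _ _
          (@DistribMulAction.toDistribSMul _ _ _ _ (mod (X.t' α)).toDistribMulAction))
          (inclT F X.quiver (.inr α) c)).symm }

end QuantumCharacter

end

/-!
The extended quiver is the framed quiver of `Q`: one new vertex `i'` with the valuation of `i`, and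
one arrow `i → i'`, for every vertex `i` of `Q`. All quantities in the theorem are then computed.

*Homological part.* Let `N_ij = #(arrows i → j) · lcm (d_i, d_j)`. The Euler form is
`∑ₙ (-1)ⁿ log_q |Extⁿ(V, W)| = ∑ d_i v_i w_i - ∑ N_ij v_i w_j` on dimension vectors
(`eulerExponent_eq`). Indeed `Hom(V, W)` and `Ext¹(V, W)` are the kernel and the cokernel of the
coboundary `∏_i Hom(V_i, W_i) → ∏_{α : i → j} Hom(V_i, W_j)`, and the higher extension groups
vanish. No projective resolutions are needed for this: in any abelian category, an extension class
of positive degree is killed by the pull-back along some epimorphism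
(`exists_epi_comp_eq_zero`). This gives `d_i a_ij = 2 δ_ij d_i - N_ij - N_ji`, and the exchange
matrix has `d_i b_ij = N_ij - N_ji`.

*The monomial change.* A source adapted ordering is one in which all arrows go from earlier to later
vertices (`SourceAdapted.lt`), so that for `i ≠ j` at most one of the two summands of `a_ij` is
nonzero, and the order tells which one. Hence `ψ = ρ_𝐢⁻¹ φ_𝐢`, which involves sums of `a_ij` over
initial or final segments, takes the concatenation of `x` and `y` to `-y* - *x`, computed in the
framed quiver (`monomialChange_eq_star`).

*Part (a).* It follows that `𝐛^j = ψ(ε_l - ε_{n+l})` where `j = i_l`, and the bicharacter of `ℒ_𝐢`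
paired with `ε_l - ε_{n+l}` is `f ↦ v ^ (2 d_j ψ(f)_j)`, which is checked on the standard basis
(`seqBichar_single_sub_single`).

*Part (b).* A flag of type `(𝐢₀, 𝐢₀)` is determined by its middle term `E`, since every vertex
occurs once in each half; conversely every subobject `E` of `V` gives a flag, since the vertices are
removed sources first (`SubRep.natCard_flags`). So the `𝐢`-character is a sum over the subobjects of
`V`. In the summand of `E`, the coefficient and the ordered product of the generators combine to
`∏_{k < l} ⟨S_{i_l}, S_{i_k}⟩ ^ (- a_k a_l)`, where only the pairs with `k` in the first and `l` in
the second half contribute, and the product is `⟨E, V/E⟩⁻¹` (`prod_eulerExponent_append`). The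
exponent of the monomial is the concatenation of `|V/E|` and `|E|`, and its image under `ψ` is
`-|E|* - *|V/E|`.
-/

universe v₁ u₁

noncomputable section

namespace QuantumCharacter

/-! ### Effaceability of extension classes -/

section Effaceable

open HomologicalComplex _root_.DerivedCategory Abelian

variable {C : Type u₁} [Category.{v₁} C] [Abelian C]

/-- A quasi-isomorphism from a complex concentrated in degrees at most `i` to an object placed in
degree `i` has a section after pull-back along an epimorphism, namely along the projection of the
term in degree `i` to its homology. -/
lemma exists_epi_single_lift {X : C} {K : CochainComplex C ℤ} {i : ℤ}
    (π : K ⟶ (single C (ComplexShape.up ℤ) i).obj X) [K.IsStrictlyLE i] [QuasiIsoAt π i] :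
    ∃ (P : C) (p : P ⟶ X) (_ : Epi p) (σ : (single C (ComplexShape.up ℤ) i).obj P ⟶ K),
      σ ≫ π = (single C (ComplexShape.up ℤ) i).map p := by
  let e := K.iCyclesIso i (i + 1) (by simp)
    ((K.isZero_of_isStrictlyLE i (i + 1) (by simp)).eq_of_tgt _ _)
  let α := e.inv ≫ K.homologyπ i ≫ homologyMap π i ≫ (singleObjHomologySelfIso _ _ _).hom
  have : π.f i = α ≫ (singleObjXSelf (ComplexShape.up ℤ) i X).inv := by
    rw [← cancel_epi e.hom]
    dsimp only [α]
    simp only [Category.assoc, Iso.hom_inv_id_assoc]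
    rw [homologyπ_naturality_assoc, homologyπ_singleObjHomologySelfIso_hom_assoc,
      ← singleObjCyclesSelfIso_inv_iCycles, Iso.hom_inv_id_assoc]
    exact (cyclesMap_i π i).symm
  refine ⟨K.X i, α, inferInstance, mkHomFromSingle (𝟙 _) (by
      rintro _ rfl
      apply (K.isZero_of_isStrictlyLE i (i + 1) (by simp)).eq_of_tgt), ?_⟩
  apply HomologicalComplex.from_single_hom_ext
  rw [comp_f, mkHomFromSingle_f, this, single_map_f_self, Category.comp_id]

lemma comp_eq_zero_of_fractions {D : Type*} [Category D] [HasZeroMorphisms D] {A K B L : D}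
    (s : A ⟶ K) (π : K ⟶ B) [IsIso π] (g : K ⟶ L) (p : A ⟶ B) (φ : B ⟶ L)
    (hp : p = s ≫ π) (hφ : φ = inv π ≫ g) (h : s ≫ g = 0) : p ≫ φ = 0 := by
  rw [hp, hφ, Category.assoc, IsIso.hom_inv_id_assoc, h]

/-- Positive degree extension classes are effaceable: each one is killed by the pull-back along
some epimorphism. This is the substitute for projective resolutions. -/
lemma exists_epi_comp_eq_zero [HasExt.{w} C] {X Y : C} {n : ℕ} (x : Ext X Y (n + 1)) :
    ∃ (P : C) (p : P ⟶ X) (_ : Epi p), (Ext.mk₀ p).comp x (zero_add _) = 0 := by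
  let := HasDerivedCategory.standard C
  let φ := x.hom ≫ ((singleFunctors C).shiftIso ((n + 1 : ℕ) : ℤ) (-(n + 1)) 0
    (by push_cast; lia)).hom.app Y
  obtain ⟨K, _, π, h, g, hg⟩ := right_fac_of_isStrictlyLE
    (X := (CochainComplex.singleFunctor C 0).obj X)
    (Y := (CochainComplex.singleFunctor C (-(n + 1))).obj Y) φ 0
  have h' : QuasiIso π := (isIso_Q_map_iff_quasiIso C π).1 h
  have h₁ : QuasiIsoAt π 0 := inferInstance
  obtain ⟨P, p, hp, σ, hσ⟩ := @exists_epi_single_lift _ _ _ _ _ 0 π _ h₁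
  refine ⟨P, p, hp, ?_⟩
  have h₂ : σ ≫ g = 0 := by
    apply HomologicalComplex.from_single_hom_ext
    apply (((CochainComplex.singleFunctor C (-(n + 1))).obj Y).isZero_of_isStrictlyLE
      (-(n + 1)) 0 (by lia)).eq_of_tgt
  have h₃ : (DerivedCategory.singleFunctor C 0).map p ≫ φ = 0 := by
    have hsg : Q.map σ ≫ Q.map g = 0 := by rw [← Q.map_comp, h₂, Q.map_zero]
    exact comp_eq_zero_of_fractions (Q.map σ) (Q.map π) (Q.map g) _ _
      ((Q.congr_map hσ).symm.trans (Q.map_comp σ π)) hg hsg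
  apply Ext.homEquiv.injective
  change ((Ext.mk₀ p).comp x (zero_add _)).hom = Ext.hom 0
  rw [Ext.comp_hom, Ext.mk₀_hom, Ext.zero_hom, ShiftedHom.mk₀_comp]
  rw [← cancel_mono (((singleFunctors C).shiftIso ((n + 1 : ℕ) : ℤ) (-(n + 1)) 0
    (by push_cast; lia)).hom.app Y)]
  rw [Category.assoc]
  exact h₃.trans zero_comp.symm

end Effaceable

variable {F : Type u} [Field F] [Finite F] {I : Type} {Q : ValuedQuiver I}

/-! ### Cocycles and the first extension group -/

namespace Rep

/-- The spaces of a representation, as vector spaces over the base field. -/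
instance moduleBase (V : Rep F Q) (i : I) : Module F (V.V i) :=
  Module.compHom _ (algebraMap F (VertexField F Q i))

theorem base_smul_def (V : Rep F Q) (i : I) (c : F) (x : V.V i) :
    c • x = algebraMap F (VertexField F Q i) c • x := rfl

instance (V : Rep F Q) (i : I) : SMulCommClass (VertexField F Q i) F (V.V i) where
  smul_comm c d x := by
    rw [base_smul_def, base_smul_def, smul_smul, smul_smul, mul_comm]

theorem map_base_smul (V : Rep F Q) (α : Q.Arrow) (c : F) (x : V.V (Q.s α)) :
    V.map α (c • x) = c • V.map α x := by
  have h := V.map_smul α (algebraMap F _ c) x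
  exact h

variable (V W : Rep F Q)

/-- Families of linear maps `V_i → W_i`, without any compatibility with the arrows. -/
abbrev VertexMaps : Type u := ∀ i, V.V i →ₗ[VertexField F Q i] W.V i

/-- Families of maps `V_i → W_j`, one for each arrow `i → j`, linear over the field of the arrow.
They are the possible off-diagonal parts of the arrow maps of an extension of `V` by `W`. -/
def cocycles : Submodule F (∀ α : Q.Arrow, V.V (Q.s α) →+ W.V (Q.t α)) where
  carrier := {c | ∀ (α : Q.Arrow) (a : ArrowField F Q α) (x : V.V (Q.s α)),
    c α (inclS F Q α a • x) = inclT F Q α a • c α x}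
  add_mem' hc hc' α a x := by simp [hc α a x, hc' α a x]
  zero_mem' α a x := by simp
  smul_mem' b c hc α a x := by
    change b • c α _ = _ • b • c α x
    rw [hc α a x]
    exact (smul_comm _ _ _).symm

variable {V W}

variable (V W) in
/-- The coboundary `(f_i) ↦ (W_α f_i - f_j V_α)_{α : i → j}`; its kernel is `Hom(V, W)`, and its
cokernel is `Ext¹(V, W)`. -/
def coboundary : VertexMaps V W →ₗ[F] cocycles V W where
  toFun f := ⟨fun α => (W.map α).comp (f (Q.s α)).toAddMonoidHom -
      (f (Q.t α)).toAddMonoidHom.comp (V.map α), fun α a x => by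
    simp [W.map_smul, V.map_smul, smul_sub]⟩
  map_add' f g := by
    ext α x
    simp
    abel
  map_smul' c f := by
    ext α x
    simp [map_base_smul, smul_sub]

theorem coboundary_apply (f : VertexMaps V W) (α : Q.Arrow) (x : V.V (Q.s α)) :
    (coboundary V W f).1 α x = W.map α (f _ x) - f _ (V.map α x) := rfl

variable (V W) in
/-- Morphisms of representations form the kernel of the coboundary. -/
def homEquivKer : (V ⟶ W) ≃ LinearMap.ker (coboundary V W) where
  toFun f := ⟨f.app, by
    rw [LinearMap.mem_ker]
    ext α x
    simp [coboundary_apply, f.comm]⟩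
  invFun f := ⟨f.1, fun α x => by
    have h := congrArg (fun c : cocycles V W => c.1 α x) (LinearMap.mem_ker.1 f.2)
    simp only [coboundary_apply] at h
    exact sub_eq_zero.1 h⟩
  left_inv f := rfl
  right_inv f := rfl

/-! #### The extension defined by a cocycle -/

/-- The extension `W ⊕ V` of `V` by `W` whose arrow maps have the given off-diagonal part. -/
def extRep (c : cocycles V W) : Rep F Q where
  V i := W.V i × V.V i
  map α := ((W.map α).comp (AddMonoidHom.fst _ _) + (c.1 α).comp (AddMonoidHom.snd _ _)).prod
    ((V.map α).comp (AddMonoidHom.snd _ _))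
  map_smul α a x := by
    ext
    · simp [W.map_smul, c.2 α a]
    · simp [V.map_smul]

/-- The inclusion of `W` into the extension. -/
def extι (c : cocycles V W) : W ⟶ extRep c :=
  ⟨fun _ => LinearMap.inl _ _ _, fun α x => Prod.ext
    ((congrArg (W.map α x + ·) (map_zero (c.1 α))).trans (add_zero _)) (map_zero (V.map α))⟩

/-- The projection of the extension to `V`. -/
def extπ (c : cocycles V W) : extRep c ⟶ V :=
  ⟨fun _ => LinearMap.snd _ _ _, fun _ _ => rfl⟩

/-- The short exact sequence `0 → W → W ⊕ V → V → 0` defined by a cocycle. -/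
def extComplex (c : cocycles V W) : ShortComplex (Rep F Q) :=
  ShortComplex.mk (extι c) (extπ c) (by ext i x; rfl)

theorem mono_of_injective {f : V ⟶ W} (h : ∀ i, Function.Injective (f.app i)) : Mono f where
  right_cancellation g g' hg := by
    ext i x
    exact h i (congrArg (fun k : _ ⟶ W => k.app i x) hg)

theorem epi_of_surjective {f : V ⟶ W} (h : ∀ i, Function.Surjective (f.app i)) : Epi f where
  left_cancellation g g' hg := by
    ext i x
    obtain ⟨y, rfl⟩ := h i x
    exact congrArg (fun k : V ⟶ _ => k.app i y) hg

theorem extComplex_shortExact (c : cocycles V W) : (extComplex c).ShortExact where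
  exact := by
    refine ShortComplex.exact_of_f_is_kernel _ (KernelFork.IsLimit.ofι (extι c) _
      (fun {Z} g hg => ⟨fun i => (LinearMap.fst _ _ _).comp (g.app i), fun α x => ?_⟩) ?_ ?_)
    · have h1 := congrArg Prod.fst (g.comm α x)
      have h2 : (g.app _ x).2 = 0 := congrArg (fun k : Z ⟶ V => k.app _ x) hg
      change W.map α (g.app _ x).1 + c.1 α (g.app _ x).2 = _ at h1
      rw [h2, map_zero, add_zero] at h1
      exact h1
    · intro Z g hg
      ext i x
      have h2 : (g.app _ x).2 = 0 := congrArg (fun k : Z ⟶ V => k.app _ x) hg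
      exact Prod.ext rfl h2.symm
    · intro Z g hg m hm
      ext i x
      exact congrArg (fun k : Z ⟶ extRep c => (k.app i x).1) hm
  mono_f := mono_of_injective fun i =>
    (LinearMap.inl_injective (R := VertexField F Q i) (M := W.V i) (M₂ := V.V i))
  epi_g := epi_of_surjective fun i =>
    (LinearMap.snd_surjective (R := VertexField F Q i) (M := W.V i) (M₂ := V.V i))

/-- The class in `Ext¹(V, W)` of the extension defined by a cocycle. -/
def extClass (c : cocycles V W) : Abelian.Ext V W 1 := (extComplex_shortExact c).extClass

/-- The push-out of a cocycle along a morphism. -/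
def pushCocycle {W' : Rep F Q} (c : cocycles V W) (g : W ⟶ W') : cocycles V W' :=
  ⟨fun α => (g.app _).toAddMonoidHom.comp (c.1 α), fun α a x => by simp [c.2 α a x]⟩

/-- The pull-back of a cocycle along a morphism. -/
def pullCocycle {V' : Rep F Q} (c : cocycles V W) (f : V' ⟶ V) : cocycles V' W :=
  ⟨fun α => (c.1 α).comp (f.app _).toAddMonoidHom, fun α a x => by simp [c.2 α a]⟩

theorem extClass_push {W' : Rep F Q} (c : cocycles V W) (g : W ⟶ W') :
    extClass (pushCocycle c g) = (extClass c).comp (.mk₀ g) (add_zero 1) := by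
  let φ : extComplex c ⟶ extComplex (pushCocycle c g) :=
    { τ₁ := g
      τ₂ := ⟨fun i => (g.app i).prodMap LinearMap.id, fun α x => by
        refine Prod.ext ?_ rfl
        change W'.map α (g.app _ x.1) + g.app _ (c.1 α x.2) = g.app _ (W.map α x.1 + c.1 α x.2)
        rw [g.comm, map_add]⟩
      τ₃ := 𝟙 V
      comm₁₂ := by
        ext i x
        exact Prod.ext rfl rfl
      comm₂₃ := rfl }
  have h := (extComplex_shortExact c).extClass_naturality
    (extComplex_shortExact (pushCocycle c g)) φ
  exact ((Abelian.Ext.mk₀_id_comp _).symm.trans h.symm)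

theorem extClass_pull {V' : Rep F Q} (c : cocycles V W) (f : V' ⟶ V) :
    extClass (pullCocycle c f) = (Abelian.Ext.mk₀ f).comp (extClass c) (zero_add 1) := by
  let φ : extComplex (pullCocycle c f) ⟶ extComplex c :=
    { τ₁ := 𝟙 W
      τ₂ := ⟨fun i => LinearMap.id.prodMap (f.app i), fun α x =>
        Prod.ext rfl (f.comm α x.2)⟩
      τ₃ := f
      comm₁₂ := by
        ext i x
        exact Prod.ext rfl (map_zero (f.app i)).symm
      comm₂₃ := rfl }
  have h := (extComplex_shortExact (pullCocycle c f)).extClass_naturality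
    (extComplex_shortExact c) φ
  exact ((Abelian.Ext.comp_mk₀_id _).symm.trans h)

/-- The Baer sum of two extensions is the push-out, along the codiagonal, of the extension given by
the pair of their cocycles. -/
theorem extClass_add (c c' : cocycles V W) : extClass (c + c') = extClass c + extClass c' := by
  let d : cocycles V (prod W W) := ⟨fun α => (c.1 α).prod (c'.1 α), fun α a x =>
    Prod.ext (c.2 α a x) (c'.2 α a x)⟩
  let p : prod W W ⟶ W := ⟨fun i => LinearMap.fst _ _ _, fun _ _ => rfl⟩
  let p' : prod W W ⟶ W := ⟨fun i => LinearMap.snd _ _ _, fun _ _ => rfl⟩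
  have h1 : pushCocycle d p = c := rfl
  have h2 : pushCocycle d p' = c' := rfl
  have h3 : pushCocycle d (p + p') = c + c' := rfl
  rw [← h3, extClass_push, Abelian.Ext.mk₀_add, Abelian.Ext.comp_add, ← extClass_push,
    ← extClass_push, h1, h2]

variable (V W) in
/-- The class of an extension, as a homomorphism on cocycles. -/
def extClassHom : cocycles V W →+ Abelian.Ext V W 1 := AddMonoidHom.mk' extClass extClass_add

theorem extClass_eq_zero_iff (c : cocycles V W) :
    extClass c = 0 ↔ c ∈ LinearMap.range (coboundary V W) := by
  constructor
  · intro h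
    obtain ⟨y, hy⟩ := Abelian.Ext.covariant_sequence_exact₃ V (extComplex_shortExact c)
      (Abelian.Ext.mk₀ (𝟙 V)) (zero_add 1)
      ((Abelian.Ext.mk₀_id_comp (extClass c)).trans h)
    obtain ⟨σ, rfl⟩ := (Abelian.Ext.mk₀_bijective _ _).2 y
    have hσ : σ ≫ extπ c = 𝟙 V := (Abelian.Ext.mk₀_bijective _ _).1
      ((Abelian.Ext.mk₀_comp_mk₀ σ (extπ c)).symm.trans hy)
    have h2 : ∀ i x, (σ.app i x).2 = x := fun i x => congrArg (fun k : V ⟶ V => k.app i x) hσ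
    refine ⟨fun i => -(LinearMap.fst _ _ _).comp (σ.app i), ?_⟩
    ext α x
    have h3 := congrArg Prod.fst (σ.comm α x)
    change W.map α (σ.app _ x).1 + c.1 α (σ.app _ x).2 = (σ.app _ (V.map α x)).1 at h3
    rw [h2] at h3
    rw [coboundary_apply]
    change W.map α (-(σ.app _ x).1) - -(σ.app _ (V.map α x)).1 = _
    rw [← h3, map_neg]
    abel
  · rintro ⟨f, rfl⟩
    let σ : V ⟶ extRep (coboundary V W f) := ⟨fun i => (-(f i)).prod LinearMap.id, fun α x => by
      refine Prod.ext ?_ rfl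
      change W.map α (-f _ x) + (W.map α (f _ x) - f _ (V.map α x)) = -f _ (V.map α x)
      rw [map_neg]
      abel⟩
    have hσ : σ ≫ extπ _ = 𝟙 V := rfl
    have h : (Abelian.Ext.mk₀ σ).comp ((Abelian.Ext.mk₀ (extπ (coboundary V W f))).comp
        (extClass (coboundary V W f)) (zero_add 1)) (zero_add 1) = 0 := by
      have := (extComplex_shortExact (coboundary V W f)).comp_extClass
      rw [show (Abelian.Ext.mk₀ (extπ (coboundary V W f))).comp
        (extClass (coboundary V W f)) (zero_add 1) = 0 from this, Abelian.Ext.comp_zero]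
    rwa [Abelian.Ext.mk₀_comp_mk₀_assoc, hσ, Abelian.Ext.mk₀_id_comp] at h

/-- The short exact sequence of an epimorphism and its kernel. -/
def kerComplex {P : Rep F Q} (p : P ⟶ V) : ShortComplex (Rep F Q) :=
  ShortComplex.mk (ker p).ι p (ker_ι p)

theorem kerComplex_shortExact {P : Rep F Q} (p : P ⟶ V) [Epi p] :
    (kerComplex p).ShortExact where
  exact := by
    refine ShortComplex.exact_of_f_is_kernel _ (KernelFork.IsLimit.ofι (ker p).ι (ker_ι p)
      (fun {Z} g hg => ⟨fun i => (g.app i).codRestrict _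
        (fun x => congrArg (fun h : Z ⟶ V => h.app i x) hg), fun α x => Subtype.ext (g.comm α x)⟩)
      (fun g hg => rfl) ?_)
    intro Z g hg m hm
    ext i x
    exact Subtype.ext (congrArg (fun h : Z ⟶ P => h.app i x) hm)
  mono_f := mono_of_injective fun i => Subtype.val_injective
  epi_g := ‹Epi p›

/-- The class of an epimorphism is given by a cocycle, obtained from linear sections at all
vertices. -/
theorem exists_extClass_eq_kerComplex {P : Rep F Q} (p : P ⟶ V) [Epi p] :
    ∃ c : cocycles V (ker p).toRep, extClass c = (kerComplex_shortExact p).extClass := by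
  choose s hs using fun i => (p.app i).exists_rightInverse_of_surjective
    (LinearMap.range_eq_top.2 (app_surjective p i))
  have hs' : ∀ i x, p.app i (s i x) = x := fun i x => LinearMap.congr_fun (hs i) x
  let c : cocycles V (ker p).toRep := ⟨fun α => ((P.map α).comp (s (Q.s α)).toAddMonoidHom -
      (s (Q.t α)).toAddMonoidHom.comp (V.map α)).codRestrict
        ((ker p).carrier (Q.t α)).toAddSubgroup (fun x => by
          change p.app _ (P.map α (s _ x) - s _ (V.map α x)) = 0
          rw [map_sub, ← p.comm, hs', hs', sub_self]), fun α a x => Subtype.ext (by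
            change P.map α (s _ (inclS F Q α a • x)) - s _ (V.map α (inclS F Q α a • x)) =
              inclT F Q α a • (P.map α (s _ x) - s _ (V.map α x))
            rw [V.map_smul, LinearMap.map_smul, LinearMap.map_smul, P.map_smul, smul_sub])⟩
  let φ : extComplex c ⟶ kerComplex p :=
    { τ₁ := 𝟙 _
      τ₂ := ⟨fun i => ((ker p).carrier i).subtype.coprod (s i), fun α x => by
        change P.map α (x.1.1 + s _ x.2) =
          (P.map α x.1.1 + (P.map α (s _ x.2) - s _ (V.map α x.2))) + s _ (V.map α x.2)
        rw [map_add]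
        abel⟩
      τ₃ := 𝟙 _
      comm₁₂ := by
        ext i x
        change x.1 = x.1 + s i 0
        rw [map_zero, add_zero]
      comm₂₃ := by
        ext i x
        change p.app i (x.1.1 + s i x.2) = x.2
        rw [map_add, hs', show p.app i x.1.1 = 0 from x.1.2, zero_add] }
  have h := (extComplex_shortExact c).extClass_naturality (kerComplex_shortExact p) φ
  exact ⟨c, (Abelian.Ext.comp_mk₀_id _).symm.trans (h.trans (Abelian.Ext.mk₀_id_comp _))⟩

/-- A class `x ∈ Ext¹(V, W)` dies on some epimorphism onto `V`, so it is the push-out of the class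
of that epimorphism, which is given by a cocycle. -/
theorem extClass_surjective : Function.Surjective (extClassHom V W) := by
  intro x
  obtain ⟨P, p, hp, h⟩ := exists_epi_comp_eq_zero x
  obtain ⟨g, hg⟩ := Abelian.Ext.contravariant_sequence_exact₃ (kerComplex_shortExact p) W x h
    (add_zero 1)
  obtain ⟨g, rfl⟩ := (Abelian.Ext.mk₀_bijective _ _).2 g
  obtain ⟨c, hc⟩ := exists_extClass_eq_kerComplex p
  refine ⟨pushCocycle c g, (extClass_push c g).trans ?_⟩
  rw [hc]
  exact hg

/-- A cocycle on a subobject extends to the whole representation. -/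
theorem exists_pull_ι_eq (E : SubRep V) (c : cocycles E.toRep W) :
    ∃ d : cocycles V W, pullCocycle d E.ι = c := by
  choose r hr using fun i => (E.carrier i).subtype.exists_leftInverse_of_injective
    (Submodule.ker_subtype _)
  refine ⟨⟨fun α => (c.1 α).comp (r (Q.s α)).toAddMonoidHom, fun α a x => ?_⟩, ?_⟩
  · change c.1 α (r _ (inclS F Q α a • x)) = _
    rw [LinearMap.map_smul]
    exact c.2 α a (r _ x)
  · ext α x
    exact congrArg (c.1 α) (LinearMap.congr_fun (hr (Q.s α)) x)

/-- The category of representations is hereditary: a class in `Ext²(V, W)` dies on some epimorphism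
`P → V`, hence comes from `Ext¹` of the kernel, and every class there extends to `P`, because
cocycles do. The higher groups vanish by induction. -/
theorem ext_eq_zero (n : ℕ) (V W : Rep F Q) (x : Abelian.Ext V W (n + 2)) : x = 0 := by
  induction n generalizing V W with
  | zero =>
    obtain ⟨P, p, hp, h⟩ := exists_epi_comp_eq_zero x
    obtain ⟨g, rfl⟩ := Abelian.Ext.contravariant_sequence_exact₃ (kerComplex_shortExact p) W x h
      (n₀ := 1) rfl
    obtain ⟨c, rfl⟩ := extClass_surjective g
    obtain ⟨d, rfl⟩ := exists_pull_ι_eq (ker p) c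
    exact (congrArg (fun y => (kerComplex_shortExact p).extClass.comp y rfl)
      (extClass_pull d (ker p).ι)).trans
      ((kerComplex_shortExact p).extClass_comp_assoc (extClass d))
  | succ n ih =>
    obtain ⟨P, p, hp, h⟩ := exists_epi_comp_eq_zero x
    obtain ⟨g, rfl⟩ := Abelian.Ext.contravariant_sequence_exact₃ (kerComplex_shortExact p) W x h
      (n₀ := n + 2) (by lia)
    obtain rfl : g = 0 := ih _ _ g
    exact Abelian.Ext.comp_zero _ _ _ _ _

end Rep

/-! ### Cardinalities -/

/-- The field `extField F a` consists of the roots of the separable polynomial `X ^ (q ^ a) - X`. -/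
theorem natCard_extField {a : ℕ} (ha : 0 < a) : Nat.card (extField F a) = Nat.card F ^ a := by
  have hq : 1 < Nat.card F := Finite.one_lt_card
  have h1 : 1 < Nat.card F ^ a := Nat.one_lt_pow ha.ne' hq
  let p : Polynomial F := Polynomial.X ^ (Nat.card F ^ a) - Polynomial.X
  obtain ⟨r, hr⟩ := CharP.exists F
  have hr0 : r ∣ Nat.card F ^ a := by
    refine dvd_pow ?_ ha.ne'
    rw [← CharP.cast_eq_zero_iff F r]
    have := Fintype.ofFinite F
    rw [Nat.card_eq_fintype_card, Nat.cast_card_eq_zero]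
  have hsep : p.Separable := by
    refine galois_poly_separable r _ hr0
  have hcard := Polynomial.card_rootSet_eq_natDegree (K := AlgebraicClosure F) hsep
    (IsAlgClosed.splits _)
  rw [← Nat.card_eq_fintype_card] at hcard
  rw [show p.natDegree = Nat.card F ^ a from FiniteField.X_pow_card_sub_X_natDegree_eq F h1]
    at hcard
  rw [← hcard]
  refine Nat.card_congr (Equiv.subtypeEquivRight fun x => ?_)
  rw [mem_extField, Polynomial.mem_rootSet_of_ne (FiniteField.X_pow_card_sub_X_ne_zero F h1)]
  simp [sub_eq_zero]

theorem finite_extField {a : ℕ} (ha : 0 < a) : Finite (extField F a) :=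
  Nat.finite_of_card_ne_zero (by
    rw [natCard_extField ha]
    exact (pow_pos Nat.card_pos a).ne')

instance (i : I) : Finite (VertexField F Q i) := finite_extField (Q.d_pos i)

instance (α : Q.Arrow) : Finite (ArrowField F Q α) :=
  finite_extField (Nat.gcd_pos_of_pos_left _ (Q.d_pos _))

theorem natCard_linearMap {K A B : Type*} [Field K] [Finite K] [AddCommGroup A] [AddCommGroup B]
    [Module K A] [Module K B] [Module.Finite K A] [Module.Finite K B] :
    Nat.card (A →ₗ[K] B) = Nat.card K ^ (Module.finrank K A * Module.finrank K B) := by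
  rw [Module.natCard_eq_pow_finrank (K := K), Module.finrank_linearMap]

namespace Rep

variable (V W : Rep F Q)

instance (i : I) : Finite (V.V i) := Module.finite_of_finite (VertexField F Q i)

theorem natCard_V (i : I) :
    Nat.card (V.V i) = Nat.card F ^ (Q.d i * Module.finrank (VertexField F Q i) (V.V i)) := by
  rw [Module.natCard_eq_pow_finrank (K := VertexField F Q i), natCard_extField (Q.d_pos i), pow_mul]

theorem natCard_vertexMaps [Fintype I] : Nat.card (VertexMaps V W) = Nat.card F ^
    (∑ i, Q.d i * (Module.finrank (VertexField F Q i) (V.V i) *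
      Module.finrank (VertexField F Q i) (W.V i))) := by
  rw [Nat.card_pi, ← Finset.prod_pow_eq_pow_sum]
  refine Finset.prod_congr rfl fun i _ => ?_
  rw [natCard_linearMap, natCard_extField (Q.d_pos i), ← pow_mul]

/-- The space at the source of an arrow, as a vector space over the field of the arrow. -/
abbrev moduleSource (α : Q.Arrow) : Module (ArrowField F Q α) (V.V (Q.s α)) :=
  Module.compHom _ (inclS F Q α)

/-- The space at the target of an arrow, as a vector space over the field of the arrow. -/
abbrev moduleTarget (α : Q.Arrow) : Module (ArrowField F Q α) (V.V (Q.t α)) :=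
  Module.compHom _ (inclT F Q α)

/-- The component at an arrow of a cocycle. -/
def cocyclesEquiv : cocycles V W ≃ ∀ α : Q.Arrow,
    letI := moduleSource V α
    letI := moduleTarget W α
    V.V (Q.s α) →ₗ[ArrowField F Q α] W.V (Q.t α) where
  toFun c α :=
    letI := moduleSource V α
    letI := moduleTarget W α
    { toFun := c.1 α, map_add' := map_add _, map_smul' := c.2 α }
  invFun c := ⟨fun α =>
    letI := moduleSource V α
    letI := moduleTarget W α
    (c α).toAddMonoidHom, fun α =>
    letI := moduleSource V α
    letI := moduleTarget W α
    (c α).map_smul⟩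
  left_inv _ := rfl
  right_inv _ := rfl

theorem natCard_arrowMaps (α : Q.Arrow) :
    letI := moduleSource V α
    letI := moduleTarget W α
    Nat.card (V.V (Q.s α) →ₗ[ArrowField F Q α] W.V (Q.t α)) = Nat.card F ^
      (Nat.lcm (Q.d (Q.s α)) (Q.d (Q.t α)) *
        (Module.finrank (VertexField F Q (Q.s α)) (V.V (Q.s α)) *
          Module.finrank (VertexField F Q (Q.t α)) (W.V (Q.t α)))) := by
  let := moduleSource V α
  let := moduleTarget W α
  have hq : 1 < Nat.card F := Finite.one_lt_card
  set g := Nat.gcd (Q.d (Q.s α)) (Q.d (Q.t α)) with hg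
  have hg0 : 0 < g := Nat.gcd_pos_of_pos_left _ (Q.d_pos _)
  have hK : Nat.card (ArrowField F Q α) = Nat.card F ^ g := natCard_extField hg0
  have : Module.Finite (ArrowField F Q α) (V.V (Q.s α)) := Module.Finite.of_finite
  have : Module.Finite (ArrowField F Q α) (W.V (Q.t α)) := Module.Finite.of_finite
  have h1 : g * Module.finrank (ArrowField F Q α) (V.V (Q.s α)) =
      Q.d (Q.s α) * Module.finrank (VertexField F Q (Q.s α)) (V.V (Q.s α)) :=
    Nat.pow_right_injective hq (by
      change Nat.card F ^ _ = Nat.card F ^ _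
      rw [pow_mul, ← hK, ← Module.natCard_eq_pow_finrank, natCard_V])
  have h2 : g * Module.finrank (ArrowField F Q α) (W.V (Q.t α)) =
      Q.d (Q.t α) * Module.finrank (VertexField F Q (Q.t α)) (W.V (Q.t α)) :=
    Nat.pow_right_injective hq (by
      change Nat.card F ^ _ = Nat.card F ^ _
      rw [pow_mul, ← hK, ← Module.natCard_eq_pow_finrank, natCard_V])
  rw [natCard_linearMap, hK, ← pow_mul]
  congr 1
  apply Nat.eq_of_mul_eq_mul_left hg0
  have h3 := Nat.gcd_mul_lcm (Q.d (Q.s α)) (Q.d (Q.t α))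
  rw [← hg] at h3
  calc _ = (g * Module.finrank (ArrowField F Q α) (V.V (Q.s α))) *
        (g * Module.finrank (ArrowField F Q α) (W.V (Q.t α))) := by ring
    _ = _ := by rw [h1, h2, ← mul_assoc g, h3]; ring

end Rep

namespace ValuedQuiver

/-- The number of arrows from `i` to `j`, times `lcm (d_i, d_j)`: the dimension over the base field
of the space of maps attached to these arrows, for one-dimensional spaces at `i` and `j`. -/
def arrowDim (Q : ValuedQuiver I) (i j : I) : ℕ :=
  Nat.card {α : Q.Arrow // Q.s α = i ∧ Q.t α = j} * Nat.lcm (Q.d i) (Q.d j)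

open Classical in
/-- Summation over the arrows, sorted by their ends. -/
theorem sum_arrow [Fintype I] (Q : ValuedQuiver I) [Fintype Q.Arrow] {M : Type*}
    [AddCommMonoid M] (f : I → I → M) :
    ∑ α : Q.Arrow, f (Q.s α) (Q.t α) =
      ∑ i, ∑ j, Nat.card {α : Q.Arrow // Q.s α = i ∧ Q.t α = j} • f i j := by
  rw [← Finset.sum_fiberwise Finset.univ (fun α => (Q.s α, Q.t α)), Fintype.sum_prod_type]
  refine Finset.sum_congr rfl fun i _ => Finset.sum_congr rfl fun j _ => ?_
  rw [Finset.sum_congr rfl (g := fun _ => f i j), Finset.sum_const, Nat.card_eq_fintype_card,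
    Fintype.card_subtype]
  · simp only [Prod.mk.injEq]
  · intro α hα
    obtain ⟨h1, h2⟩ := Prod.mk.inj (Finset.mem_filter.1 hα).2
    rw [h1, h2]

end ValuedQuiver

namespace Rep

variable (V W : Rep F Q)

theorem natCard_cocycles [Fintype I] : Nat.card (cocycles V W) = Nat.card F ^
    (∑ i, ∑ j, Q.arrowDim i j * (Module.finrank (VertexField F Q i) (V.V i) *
      Module.finrank (VertexField F Q j) (W.V j))) := by
  have := Q.finite_arrow
  have := Fintype.ofFinite Q.Arrow
  have h := Q.sum_arrow fun i j => Nat.lcm (Q.d i) (Q.d j) *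
    (Module.finrank (VertexField F Q i) (V.V i) * Module.finrank (VertexField F Q j) (W.V j))
  simp only [smul_eq_mul, ← mul_assoc] at h
  simp only [ValuedQuiver.arrowDim, ← mul_assoc]
  rw [← h, Nat.card_congr (cocyclesEquiv V W), Nat.card_pi, ← Finset.prod_pow_eq_pow_sum]
  refine Finset.prod_congr rfl fun α _ => ?_
  rw [natCard_arrowMaps, mul_assoc]

/-- The first isomorphism theorem for the coboundary, with dimensions over the base field: `r` is
its rank. -/
theorem exists_natCard_hom_ext [Fintype I] : ∃ h e r : ℕ,
    Nat.card (V ⟶ W) = Nat.card F ^ h ∧ Nat.card (Abelian.Ext V W 1) = Nat.card F ^ e ∧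
    h + r = ∑ i, Q.d i * (Module.finrank (VertexField F Q i) (V.V i) *
      Module.finrank (VertexField F Q i) (W.V i)) ∧
    e + r = ∑ i, ∑ j, Q.arrowDim i j * (Module.finrank (VertexField F Q i) (V.V i) *
      Module.finrank (VertexField F Q j) (W.V j)) := by
  have hq : 1 < Nat.card F := Finite.one_lt_card
  have hf0 : Finite (VertexMaps V W) := Nat.finite_of_card_ne_zero (by
    rw [natCard_vertexMaps]; exact (pow_pos Nat.card_pos _).ne')
  have hf1 : Finite (cocycles V W) := Nat.finite_of_card_ne_zero (by
    rw [natCard_cocycles]; exact (pow_pos Nat.card_pos _).ne')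
  have : Module.Finite F (VertexMaps V W) := Module.Finite.of_finite
  have : Module.Finite F (cocycles V W) := Module.Finite.of_finite
  have h0 := natCard_vertexMaps V W
  have h1 := natCard_cocycles V W
  rw [Module.natCard_eq_pow_finrank (K := F)] at h0 h1
  refine ⟨Module.finrank F (LinearMap.ker (coboundary V W)),
    Module.finrank F (cocycles V W ⧸ LinearMap.range (coboundary V W)),
    Module.finrank F (LinearMap.range (coboundary V W)), ?_, ?_, ?_, ?_⟩
  · rw [Nat.card_congr (homEquivKer V W), Module.natCard_eq_pow_finrank (K := F)]
  · rw [← Module.natCard_eq_pow_finrank (K := F)]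
    have hker : (extClassHom V W).ker = (LinearMap.range (coboundary V W)).toAddSubgroup := by
      ext c
      exact extClass_eq_zero_iff c
    exact Nat.card_congr (((QuotientAddGroup.quotientAddEquivOfEq hker.symm).trans
      (QuotientAddGroup.quotientKerEquivOfSurjective _ extClass_surjective)).toEquiv.symm)
  · rw [add_comm, LinearMap.finrank_range_add_finrank_ker]
    exact Nat.pow_right_injective hq h0
  · rw [Submodule.finrank_quotient_add_finrank]
    exact Nat.pow_right_injective hq h1

end Rep

/-- The Euler form on dimension vectors. -/
def eulerForm [Fintype I] (Q : ValuedQuiver I) (x y : I → ℤ) : ℤ :=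
  ∑ i, Q.d i * (x i * y i) - ∑ i, ∑ j, Q.arrowDim i j * (x i * y j)

/-- The homological Euler form depends on the dimension vectors only, and is given by the quiver. -/
theorem eulerExponent_eq [Fintype I] (V W : Rep F Q) :
    eulerExponent V W = eulerForm Q V.dim W.dim := by
  have hq : 1 < Nat.card F := Finite.one_lt_card
  obtain ⟨h, e, r, h1, h2, h3, h4⟩ := Rep.exists_natCard_hom_ext V W
  have h0 : Nat.card (Abelian.Ext V W 0) = Nat.card F ^ h := by
    rw [← h1, Nat.card_congr Abelian.Ext.homEquiv₀]
  rw [eulerExponent, finsum_eq_sum_of_support_subset (s := Finset.range 2), Finset.sum_range_succ,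
    Finset.sum_range_one, h0, h2, Nat.log_pow hq, Nat.log_pow hq]
  · have h3' := congrArg (Nat.cast : ℕ → ℤ) h3
    have h4' := congrArg (Nat.cast : ℕ → ℤ) h4
    push_cast at h3' h4'
    simp only [eulerForm, Rep.dim]
    rw [← h3', ← h4']
    ring
  · intro n hn
    by_contra hn'
    simp only [Finset.coe_range, Set.mem_Iio, not_lt] at hn'
    obtain ⟨k, rfl⟩ := Nat.exists_eq_add_of_le' hn'
    have : Subsingleton (Abelian.Ext V W (k + 2)) :=
      ⟨fun x y => (Rep.ext_eq_zero k V W x).trans (Rep.ext_eq_zero k V W y).symm⟩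
    apply hn
    simp

/-! ### Simple representations, the Cartan matrix and the exchange matrix -/

namespace ValuedQuiver

theorem arrowDim_eq_zero {Q : ValuedQuiver I} {i j : I}
    (h : ∀ α : Q.Arrow, Q.s α = i → Q.t α ≠ j) : Q.arrowDim i j = 0 := by
  have : IsEmpty {α : Q.Arrow // Q.s α = i ∧ Q.t α = j} := ⟨fun α => h α.1 α.2.1 α.2.2⟩
  rw [arrowDim, Nat.card_of_isEmpty, zero_mul]

theorem Acyclic.arrowDim_self (hQ : Q.Acyclic) (i : I) : Q.arrowDim i i = 0 :=
  arrowDim_eq_zero fun α h h' => hQ i (.single ⟨α, h, h'⟩)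

theorem Acyclic.arrowDim_eq_zero_or (hQ : Q.Acyclic) (i j : I) :
    Q.arrowDim i j = 0 ∨ Q.arrowDim j i = 0 := by
  by_contra! h
  refine h.1 (arrowDim_eq_zero fun α h1 h2 => h.2 (arrowDim_eq_zero fun β h3 h4 => ?_))
  exact hQ i (.tail (.single ⟨α, h1, h2⟩) ⟨β, h3, h4⟩)

theorem dvd_arrowDim_left (Q : ValuedQuiver I) (i j : I) : Q.d i ∣ Q.arrowDim i j :=
  (Nat.dvd_lcm_left _ _).mul_left _

theorem dvd_arrowDim_right (Q : ValuedQuiver I) (i j : I) : Q.d i ∣ Q.arrowDim j i :=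
  (Nat.dvd_lcm_right _ _).mul_left _

end ValuedQuiver

open Classical in
theorem finrank_simple (i j : I) :
    Module.finrank (VertexField F Q j) ((simple F Q i).V j) = if j = i then 1 else 0 := by
  change Module.finrank (VertexField F Q j) (PLift (j = i) → VertexField F Q j) = _
  rw [Module.finrank_fintype_fun_eq_card]
  split_ifs with h
  · have : Unique (PLift (j = i)) := ⟨⟨⟨h⟩⟩, fun _ => rfl⟩
    exact Fintype.card_unique
  · have : IsEmpty (PLift (j = i)) := ⟨fun x => h x.down⟩
    exact Fintype.card_eq_zero

open Classical in
theorem dim_simple (i : I) : (simple F Q i).dim = Pi.single i 1 := by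
  ext j
  rw [Rep.dim, finrank_simple, Pi.single_apply]
  split_ifs <;> rfl

section Acyclic

variable [Fintype I]

theorem natCard_hom_ext_simple (hQ : Q.Acyclic) (i j : I) :
    Nat.card (simple F Q i ⟶ simple F Q i) = Nat.card F ^ Q.d i ∧
      Nat.card (ExtSimple F Q i j) = Nat.card F ^ Q.arrowDim i j := by
  classical
  constructor
  · obtain ⟨h, e, r, h1, -, h3, h4⟩ := Rep.exists_natCard_hom_ext (simple F Q i) (simple F Q i)
    simp only [finrank_simple, mul_ite, mul_one, mul_zero, Finset.sum_ite_eq', Finset.mem_univ,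
      if_true, hQ.arrowDim_self] at h3 h4
    rw [h1, ← h3]
    congr 1
    simp at h4
    lia
  · obtain ⟨h, e, r, -, h2, h3, h4⟩ := Rep.exists_natCard_hom_ext (simple F Q i) (simple F Q j)
    have h4' : e + r = Q.arrowDim i j := by
      rw [h4]
      simp [finrank_simple]
    rw [h2, ← h4']
    congr 1
    by_cases hij : i = j
    · subst hij
      rw [hQ.arrowDim_self] at h4'
      lia
    · have h3' : h + r = 0 := by
        rw [h3]
        simp [finrank_simple, Ne.symm hij]
      lia

theorem log_natCard_end (hQ : Q.Acyclic) (i : I) :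
    Nat.log (Nat.card F) (Nat.card (simple F Q i ⟶ simple F Q i)) = Q.d i := by
  rw [(natCard_hom_ext_simple hQ i i).1, Nat.log_pow Finite.one_lt_card]

theorem dimOverEnd_eq (hQ : Q.Acyclic) (i : I) {M : Type*} {k : ℕ}
    (hM : Nat.card M = Nat.card F ^ k) (hk : Q.d i ∣ k) : dimOverEnd F Q i M = k / Q.d i := by
  obtain ⟨l, rfl⟩ := hk
  rw [dimOverEnd, (natCard_hom_ext_simple hQ i i).1, hM, pow_mul,
    Nat.log_pow (Nat.one_lt_pow (Q.d_pos i).ne' Finite.one_lt_card),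
    Nat.mul_div_cancel_left _ (Q.d_pos i)]

theorem dimOverEnd_ext (hQ : Q.Acyclic) (i j : I) :
    dimOverEnd F Q i (ExtSimple F Q i j) = Q.arrowDim i j / Q.d i ∧
      dimOverEnd F Q i (ExtSimple F Q j i) = Q.arrowDim j i / Q.d i :=
  ⟨dimOverEnd_eq hQ i (natCard_hom_ext_simple hQ i j).2 (Q.dvd_arrowDim_left i j),
    dimOverEnd_eq hQ i (natCard_hom_ext_simple hQ j i).2 (Q.dvd_arrowDim_right i j)⟩

theorem cartan_of_ne (hQ : Q.Acyclic) {i j : I} (hij : i ≠ j) :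
    cartan F Q i j = -(Q.arrowDim i j / Q.d i : ℕ) - (Q.arrowDim j i / Q.d i : ℕ) := by
  rw [cartan, if_neg hij, (dimOverEnd_ext hQ i j).1, (dimOverEnd_ext hQ i j).2]

open Classical in
/-- The Cartan matrix is symmetrizable: `d_i a_ij = (|S_i|, |S_j|) + (|S_j|, |S_i|)` for the Euler
form. -/
theorem d_mul_cartan (hQ : Q.Acyclic) (i j : I) :
    Q.d i * cartan F Q i j =
      (if i = j then 2 * Q.d i else 0 : ℤ) - Q.arrowDim i j - Q.arrowDim j i := by
  by_cases hij : i = j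
  · subst hij
    rw [cartan_self, if_pos rfl, hQ.arrowDim_self]
    push_cast
    ring
  · rw [cartan_of_ne hQ hij, if_neg hij, mul_sub, mul_neg, ← Nat.cast_mul, ← Nat.cast_mul,
      Nat.mul_div_cancel' (Q.dvd_arrowDim_left i j), Nat.mul_div_cancel' (Q.dvd_arrowDim_right i j)]
    ring

theorem nontrivial_extSimple_iff (hQ : Q.Acyclic) (i j : I) :
    Nontrivial (ExtSimple F Q i j) ↔ Q.arrowDim i j ≠ 0 := by
  have h := (natCard_hom_ext_simple (F := F) hQ i j).2
  have : Finite (ExtSimple F Q i j) := Nat.finite_of_card_ne_zero (by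
    rw [h]; exact (pow_pos Nat.card_pos _).ne')
  rw [← Finite.one_lt_card_iff_nontrivial, h]
  exact ⟨fun h0 h' => by simp [h'] at h0, fun h' => Nat.one_lt_pow h' Finite.one_lt_card⟩

theorem max_exchange (hQ : Q.Acyclic) (i j : I) :
    max (exchange F Q i j) 0 = (Q.arrowDim i j / Q.d i : ℕ) ∧
      max (-exchange F Q i j) 0 = (Q.arrowDim j i / Q.d i : ℕ) := by
  rw [exchange, nontrivial_extSimple_iff hQ, nontrivial_extSimple_iff hQ,
    (dimOverEnd_ext hQ i j).1, (dimOverEnd_ext hQ i j).2]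
  have h1 := Int.natCast_nonneg (Q.arrowDim i j / Q.d i)
  have h2 := Int.natCast_nonneg (Q.arrowDim j i / Q.d i)
  rcases hQ.arrowDim_eq_zero_or i j with h | h
  · by_cases h' : Q.arrowDim j i = 0
    · simp [h, h']
    · rw [if_neg (by simpa using h), if_pos h']
      rw [h, Nat.zero_div]
      constructor
      · rw [max_eq_right (by lia)]; rfl
      · rw [neg_neg, max_eq_left h2]
  · by_cases h' : Q.arrowDim i j = 0
    · simp [h, h']
    · rw [if_pos h', h, Nat.zero_div]
      constructor
      · rw [max_eq_left h1]
      · rw [max_eq_right (by lia)]; rfl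

open Classical in
theorem eulerExponent_simple (i j : I) : eulerExponent (simple F Q i) (simple F Q j) =
    (if i = j then Q.d i else 0 : ℤ) - Q.arrowDim i j := by
  rw [eulerExponent_eq, dim_simple, dim_simple, eulerForm]
  congr 1
  · by_cases h : i = j
    · subst h
      rw [Finset.sum_eq_single i] <;> simp +contextual
    · rw [if_neg h]
      refine Finset.sum_eq_zero fun k _ => ?_
      by_cases hk : k = i
      · subst hk
        simp [h]
      · simp [hk]
  · rw [Finset.sum_eq_single i, Finset.sum_eq_single j] <;> simp +contextual

end Acyclic

/-! ### Source adapted orderings and the framed quiver -/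

namespace ValuedQuiver

theorem acyclic_of_lt {r : I → ℕ} (h : ∀ α : Q.Arrow, r (Q.s α) < r (Q.t α)) : Q.Acyclic := by
  intro i hi
  have h1 : ∀ j, Relation.TransGen (fun a b => ∃ α : Q.Arrow, Q.s α = a ∧ Q.t α = b) i j →
      r i < r j := fun j hj => by
    induction hj with
    | single hα =>
      obtain ⟨α, rfl, rfl⟩ := hα
      exact h α
    | tail _ hα ih =>
      obtain ⟨α, rfl, rfl⟩ := hα
      exact ih.trans (h α)
  exact lt_irrefl _ (h1 i hi)

/-- The reflections at the vertices before the target of an arrow have to turn it around, so its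
source comes earlier. -/
theorem SourceAdapted.s_mem {l : List I} : ∀ {Q : ValuedQuiver I}, Q.SourceAdapted l →
    l.Nodup → ∀ (α : Q.Arrow) {l₁ l₂ : List I}, l = l₁ ++ Q.t α :: l₂ → Q.s α ∈ l₁ := by
  induction l with
  | nil => simp
  | cons i l ih =>
    intro Q h hn α l₁ l₂ hl
    cases l₁ with
    | nil => exact absurd (List.cons.inj hl).1.symm (h.1 α)
    | cons i' l₁ =>
      obtain ⟨rfl, hl'⟩ := List.cons.inj hl
      by_cases hs : Q.s α = i
      · exact hs ▸ List.mem_cons_self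
      have ht : Q.t α ≠ i := fun ht => (List.nodup_cons.1 hn).1 (by simp [hl', ht])
      have h3 : ¬(Q.s α = i ∨ Q.t α = i) := by simp [hs, ht]
      have h1 : (Q.reflect i).t α = Q.t α := if_neg h3
      have h2 : (Q.reflect i).s α = Q.s α := if_neg h3
      have := ih h.2 (List.nodup_cons.1 hn).2 α (l₁ := l₁) (l₂ := l₂) (by rw [h1]; exact hl')
      rw [h2] at this
      exact List.mem_cons_of_mem _ this

variable {n : ℕ} {i₀ : Fin n ≃ I}

/-- In a source adapted ordering of all vertices, arrows go from earlier to later vertices. -/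
theorem SourceAdapted.lt (h : Q.SourceAdapted (List.ofFn i₀)) (α : Q.Arrow) :
    i₀.symm (Q.s α) < i₀.symm (Q.t α) := by
  set k := i₀.symm (Q.t α) with hk
  have hk' : (k : ℕ) < (List.ofFn i₀).length := by simp
  have hl : List.ofFn i₀ = (List.ofFn i₀).take k ++ Q.t α :: (List.ofFn i₀).drop (k + 1) := by
    have h1 : (List.ofFn i₀)[(k : ℕ)] = Q.t α := by simp [hk]
    rw [← h1, List.cons_getElem_drop_succ, List.take_append_drop]
  have h1 := h.s_mem (List.nodup_ofFn_ofInjective i₀.injective) α hl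
  obtain ⟨j, hj, hj'⟩ := List.mem_take_iff_getElem.1 h1
  rw [List.getElem_ofFn] at hj'
  rw [← hj', Equiv.symm_apply_apply]
  exact Fin.lt_def.2 (lt_of_lt_of_le hj (min_le_left _ _))

variable (Q i₀) in
/-- The framed quiver: for every vertex `i` of `Q` there is a new vertex `i'` with the valuation of
`i` and one arrow `i → i'`. -/
def frame : Q.Extension (Fin n) where
  d' k := Q.d (i₀ k)
  d'_pos k := Q.d_pos (i₀ k)
  NewArrow := Fin n
  finite_newArrow := inferInstance
  s' k := .inl (i₀ k)
  t' k := .inr k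
  not_both k h := by simp at h

theorem frame_acyclic (h : Q.SourceAdapted (List.ofFn i₀)) : (Q.frame i₀).quiver.Acyclic := by
  refine acyclic_of_lt (r := Sum.elim (fun i => (i₀.symm i : ℕ)) (fun k : Fin n => n + k.1)) ?_
  rintro (α | k)
  · exact h.lt α
  · change (i₀.symm (i₀ k) : ℕ) < n + Fin.val (n := n) k
    have := (i₀.symm (i₀ k)).2
    lia

theorem frame_arrowDim_inl_inl (i j : I) :
    (Q.frame i₀).quiver.arrowDim (.inl i) (.inl j) = Q.arrowDim i j := by
  rw [arrowDim, arrowDim]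
  congr 1
  refine Nat.card_congr ⟨fun α => match α with
    | ⟨.inl α, h⟩ => ⟨α, Sum.inl_injective h.1, Sum.inl_injective h.2⟩
    | ⟨.inr k, h⟩ => absurd h.2 Sum.inr_ne_inl,
    fun α => ⟨.inl α.1, congrArg _ α.2.1, congrArg _ α.2.2⟩, ?_, fun α => rfl⟩
  rintro ⟨α | k, h⟩
  · rfl
  · exact absurd h.2 Sum.inr_ne_inl

open Classical in
theorem frame_arrowDim_inl_inr (i : I) (k : Fin n) :
    (Q.frame i₀).quiver.arrowDim (.inl i) (.inr k) = if i = i₀ k then Q.d i else 0 := by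
  split_ifs with h
  · rw [arrowDim, show Nat.lcm _ _ = Q.d i by
      change Nat.lcm (Q.d i) (Q.d (i₀ k)) = Q.d i
      rw [← h, Nat.lcm_self]]
    rw [Nat.card_eq_one_iff_unique.2, one_mul]
    refine ⟨⟨?_⟩, ⟨⟨.inr k, congrArg _ h.symm, rfl⟩⟩⟩
    rintro ⟨α | l, h1⟩ ⟨β | l', h2⟩
    · exact absurd h1.2 Sum.inl_ne_inr
    · exact absurd h1.2 Sum.inl_ne_inr
    · exact absurd h2.2 Sum.inl_ne_inr
    · have e1 : l = k := Sum.inr_injective h1.2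
      have e2 : l' = k := Sum.inr_injective h2.2
      subst e1 e2
      rfl
  · refine arrowDim_eq_zero ?_
    rintro (α | l) h1 h2
    · exact Sum.inl_ne_inr h2
    · have e1 : l = k := Sum.inr_injective h2
      have e2 : i₀ l = i := Sum.inl_injective h1
      exact h (by rw [← e1, e2])

theorem frame_arrowDim_inr (k : Fin n) (x : I ⊕ Fin n) :
    (Q.frame i₀).quiver.arrowDim (.inr k) x = 0 := by
  refine arrowDim_eq_zero ?_
  rintro (α | l) h1
  · exact absurd h1 Sum.inl_ne_inr
  · exact absurd h1 Sum.inl_ne_inr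

end ValuedQuiver

/-! ### The monomial change -/

section MonomialChange

variable {n : ℕ} (i₀ : Fin n ≃ I)

theorem next_castAdd (k : Fin n) : next (Fin.append i₀ i₀) (Fin.castAdd n k) = n + k := by
  refine IsLeast.csInf_eq ⟨Or.inl ⟨by lia, ?_, ?_⟩, ?_⟩
  · have := k.2
    simp
    lia
  · exact (Fin.append_right _ _ k).trans (Fin.append_left _ _ k).symm
  · rintro l (⟨h, h1, h2⟩ | h)
    · rw [Fin.append_left] at h2
      obtain ⟨x, hx⟩ : ∃ x : Fin (n + n), x = ⟨l, h⟩ := ⟨_, rfl⟩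
      have hl : l = x := by rw [hx]
      rw [← hx] at h2
      subst hl
      induction x using Fin.addCases with
      | left x =>
        rw [Fin.append_left] at h2
        rw [i₀.injective h2] at h1
        simp at h1
      | right x =>
        rw [Fin.append_right] at h2
        rw [i₀.injective h2, Fin.val_natAdd]
    · rw [Set.mem_singleton_iff.1 h]
      lia

theorem next_natAdd (k : Fin n) : next (Fin.append i₀ i₀) (Fin.natAdd n k) = n + n := by
  refine IsLeast.csInf_eq ⟨Or.inr rfl, ?_⟩
  rintro l (⟨h, h1, h2⟩ | h)
  · rw [Fin.append_right] at h2
    obtain ⟨x, hx⟩ : ∃ x : Fin (n + n), x = ⟨l, h⟩ := ⟨_, rfl⟩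
    have hl : l = x := by rw [hx]
    rw [← hx] at h2
    subst hl
    induction x using Fin.addCases with
    | left x =>
      simp at h1
      lia
    | right x =>
      rw [Fin.append_right] at h2
      rw [i₀.injective h2] at h1
      simp at h1
  · exact (Set.mem_singleton_iff.1 h).ge

variable (A : I → I → ℤ)

/-- The automorphism `φ_𝐢` for `𝐢 = (𝐢₀, 𝐢₀)` in block form: here `k⁺ = n + k` in the first block
and `k⁺ = 2n` in the second one. -/
theorem phi_append (p s : Fin n → ℤ) :
    phi A (Fin.append i₀ i₀) (Fin.append p s) = Fin.append
      (fun l => -p l - s l - (∑ k, if l < k then A (i₀ l) (i₀ k) * p k else 0) -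
        ∑ k, if k < l then A (i₀ l) (i₀ k) * s k else 0)
      (fun l => -s l - ∑ k, if l < k then A (i₀ l) (i₀ k) * s k else 0) := by
  ext x
  change ∑ y, phiMatrix A (Fin.append i₀ i₀) x y * Fin.append p s y = _
  rw [Fin.sum_univ_add]
  simp only [Fin.append_left, Fin.append_right]
  induction x using Fin.addCases with
  | left l =>
    rw [Fin.append_left]
    have h1 : ∀ k, phiMatrix A (Fin.append i₀ i₀) (Fin.castAdd n l) (Fin.castAdd n k) * p k =
        -(if l = k then p k else 0) - (if l < k then A (i₀ l) (i₀ k) * p k else 0) := fun k => by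
      simp only [phiMatrix, next_castAdd, Fin.append_left, Fin.ext_iff, Fin.lt_def,
        Fin.val_castAdd]
      have h1 := k.2
      have h2 := l.2
      split_ifs <;> first | (exfalso; lia) | ring
    have h2 : ∀ k, phiMatrix A (Fin.append i₀ i₀) (Fin.castAdd n l) (Fin.natAdd n k) * s k =
        -(if l = k then s k else 0) - (if k < l then A (i₀ l) (i₀ k) * s k else 0) := fun k => by
      simp only [phiMatrix, next_castAdd, Fin.append_left, Fin.append_right, Fin.ext_iff,
        Fin.lt_def, Fin.val_castAdd, Fin.val_natAdd]
      have h1 := k.2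
      have h2 := l.2
      split_ifs <;> first | (exfalso; lia) | ring
    simp only [h1, h2, Finset.sum_sub_distrib, Finset.sum_neg_distrib, Finset.sum_ite_eq,
      Finset.mem_univ, if_true]
    ring
  | right l =>
    rw [Fin.append_right]
    have h1 : ∀ k, phiMatrix A (Fin.append i₀ i₀) (Fin.natAdd n l) (Fin.castAdd n k) * p k = 0 :=
        fun k => by
      simp only [phiMatrix, next_natAdd, Fin.append_left, Fin.append_right, Fin.ext_iff, Fin.lt_def,
        Fin.val_castAdd, Fin.val_natAdd]
      have h1 := k.2
      have h2 := l.2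
      split_ifs <;> first | (exfalso; lia) | ring
    have h2 : ∀ k, phiMatrix A (Fin.append i₀ i₀) (Fin.natAdd n l) (Fin.natAdd n k) * s k =
        -(if l = k then s k else 0) - (if l < k then A (i₀ l) (i₀ k) * s k else 0) := fun k => by
      simp only [phiMatrix, next_natAdd, Fin.append_right, Fin.ext_iff, Fin.lt_def,
        Fin.val_natAdd]
      have h1 := k.2
      have h2 := l.2
      split_ifs <;> first | (exfalso; lia) | ring
    simp only [h1, h2, Finset.sum_sub_distrib, Finset.sum_neg_distrib, Finset.sum_ite_eq,
      Finset.mem_univ, if_true, Finset.sum_const_zero, zero_add]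

/-- The automorphism `ρ_𝐢` for `𝐢 = (𝐢₀, 𝐢₀)` in block form; it is the identity on the first
block. -/
theorem rho_append (hA : ∀ j, A j j = 2) (x y : Fin n → ℤ) :
    rho A (Fin.append i₀ i₀) hA (Fin.append x y) = Fin.append x
      (fun l => -y l - ∑ k, if l < k then A (i₀ l) (i₀ k) * y k else 0) := by
  ext z
  change ∑ z', rhoMatrix A (Fin.append i₀ i₀) z z' * Fin.append x y z' = _
  rw [Fin.sum_univ_add]
  simp only [Fin.append_left, Fin.append_right]
  induction z using Fin.addCases with
  | left l =>
    rw [Fin.append_left]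
    have h1 : ∀ k, rhoMatrix A (Fin.append i₀ i₀) (Fin.castAdd n l) (Fin.castAdd n k) * x k =
        if l = k then x k else 0 := fun k => by
      simp only [rhoMatrix, next_castAdd, Fin.append_left, Fin.ext_iff, Fin.le_def,
        Fin.val_castAdd]
      have h1 := k.2
      have h2 := l.2
      split_ifs <;> first | (exfalso; lia) | ring
    have h2 : ∀ k, rhoMatrix A (Fin.append i₀ i₀) (Fin.castAdd n l) (Fin.natAdd n k) * y k = 0 :=
        fun k => by
      simp only [rhoMatrix, next_castAdd, Fin.append_left, Fin.append_right, Fin.ext_iff,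
        Fin.le_def, Fin.val_castAdd, Fin.val_natAdd]
      have h1 := k.2
      have h2 := l.2
      split_ifs <;> first | (exfalso; lia) | ring
    simp only [h1, h2, Finset.sum_ite_eq, Finset.mem_univ, if_true, Finset.sum_const_zero,
      add_zero]
  | right l =>
    rw [Fin.append_right]
    have h1 : ∀ k, rhoMatrix A (Fin.append i₀ i₀) (Fin.natAdd n l) (Fin.castAdd n k) * x k = 0 :=
        fun k => by
      simp only [rhoMatrix, next_natAdd, Fin.append_left, Fin.append_right, Fin.ext_iff, Fin.le_def,
        Fin.val_castAdd, Fin.val_natAdd]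
      have h1 := k.2
      have h2 := l.2
      split_ifs <;> first | (exfalso; lia) | ring
    have h2 : ∀ k, rhoMatrix A (Fin.append i₀ i₀) (Fin.natAdd n l) (Fin.natAdd n k) * y k =
        -(if l = k then y k else 0) - (if l < k then A (i₀ l) (i₀ k) * y k else 0) := fun k => by
      rcases eq_or_ne l k with h | h
      · subst h
        simp only [rhoMatrix, next_natAdd, Fin.append_right, hA, le_refl, lt_irrefl, and_self,
          if_true, if_false]
        ring
      · have h' : (l : ℕ) ≠ k := fun h' => h (Fin.ext h')
        simp only [rhoMatrix, next_natAdd, Fin.append_right, Fin.ext_iff, Fin.lt_def, Fin.le_def,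
          Fin.val_natAdd]
        split_ifs <;> first | (exfalso; lia) | ring
    simp only [h1, h2, Finset.sum_sub_distrib, Finset.sum_neg_distrib, Finset.sum_ite_eq,
      Finset.mem_univ, if_true, Finset.sum_const_zero, zero_add]

variable (F Q) in
/-- The map `ρ_𝐢⁻¹ φ_𝐢` in block form. It need not be computed by inverting `ρ_𝐢`: applying `ρ_𝐢`
to the right-hand side gives `φ_𝐢`. -/
theorem monomialChange_append (p s : Fin n → ℤ) :
    monomialChange F Q i₀ (Fin.append p s) = Sum.elim
      (fun i => -p (i₀.symm i) - s (i₀.symm i) -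
        (∑ k, if i₀.symm i < k then cartan F Q i (i₀ k) * p k else 0) -
        ∑ k, if k < i₀.symm i then cartan F Q i (i₀ k) * s k else 0) s := by
  have h : rhoInvPhi (cartan F Q) (Fin.append i₀ i₀) (cartan_self F Q) (Fin.append p s) =
      Fin.append (fun l => -p l - s l -
        (∑ k, if l < k then cartan F Q (i₀ l) (i₀ k) * p k else 0) -
        ∑ k, if k < l then cartan F Q (i₀ l) (i₀ k) * s k else 0) s := by
    refine (LinearEquiv.symm_apply_eq _).2 ?_
    exact (phi_append i₀ _ p s).trans (rho_append i₀ _ _ _ _).symm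
  change relabel i₀ (rhoInvPhi (cartan F Q) (Fin.append i₀ i₀) (cartan_self F Q)
    (Fin.append p s)) = _
  rw [h]
  ext x
  rcases x with i | k <;>
    simp [relabel, LinearEquiv.funCongrLeft_apply, LinearMap.funLeft_apply, -Fin.natAdd_eq_addNat]

end MonomialChange

/-! ### Compatibility of the bicharacter with the framed quiver -/

section Star

theorem arrowDim_eq_zero_of_le {n : ℕ} {i₀ : Fin n ≃ I} (h : Q.SourceAdapted (List.ofFn i₀))
    {i j : I} (hij : i₀.symm j ≤ i₀.symm i) : Q.arrowDim i j = 0 :=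
  ValuedQuiver.arrowDim_eq_zero fun α h1 h2 => by
    have := h.lt α
    rw [h1, h2] at this
    exact absurd this hij.not_gt

variable [Fintype I]

theorem leftStar_apply (hQ : Q.Acyclic) (e : I → ℤ) (i : I) :
    leftStar F Q e i = e i - ∑ j, (Q.arrowDim i j / Q.d i : ℕ) * e j := by
  simp only [leftStar, (max_exchange hQ _ _).1]

theorem rightStar_apply (hQ : Q.Acyclic) (e : I → ℤ) (i : I) :
    rightStar F Q e i = e i - ∑ j, (Q.arrowDim j i / Q.d i : ℕ) * e j := by
  simp only [rightStar, (max_exchange hQ _ _).2]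

variable {n : ℕ} {i₀ : Fin n ≃ I}

theorem mul_cartan_eq (hQ : Q.Acyclic) (h : Q.SourceAdapted (List.ofFn i₀)) (i : I) (x : ℤ)
    (k : Fin n) :
    ((Q.arrowDim i (i₀ k) / Q.d i : ℕ) * x =
        -(if i₀.symm i < k then cartan F Q i (i₀ k) * x else 0)) ∧
      ((Q.arrowDim (i₀ k) i / Q.d i : ℕ) * x =
        -(if k < i₀.symm i then cartan F Q i (i₀ k) * x else 0)) := by
  have hne : i₀.symm i ≠ k → i ≠ i₀ k := fun h1 h2 => h1 (by rw [h2, Equiv.symm_apply_apply])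
  have h1 : k ≤ i₀.symm i → Q.arrowDim i (i₀ k) = 0 := fun h1 =>
    arrowDim_eq_zero_of_le h (by rwa [Equiv.symm_apply_apply])
  have h2 : i₀.symm i ≤ k → Q.arrowDim (i₀ k) i = 0 := fun h1 =>
    arrowDim_eq_zero_of_le h (by rwa [Equiv.symm_apply_apply])
  rcases lt_trichotomy (i₀.symm i) k with hk | hk | hk
  · rw [if_pos hk, if_neg hk.not_gt, cartan_of_ne hQ (hne hk.ne), h2 hk.le]
    simp
  · rw [if_neg hk.not_lt, if_neg hk.symm.not_lt, h1 hk.ge, h2 hk.le]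
    simp
  · rw [if_neg hk.not_gt, if_pos hk, cartan_of_ne hQ (hne hk.ne'), h1 hk.le]
    simp

/-- The monomial change turns dimension vectors of a filtration with sub `y` and quotient `x` into
the exponents of the quantum cluster character over the framed quiver. -/
theorem monomialChange_eq_star (hQ : Q.Acyclic) (h : Q.SourceAdapted (List.ofFn i₀))
    (x y : I → ℤ) :
    monomialChange F Q i₀ (Fin.append (x ∘ i₀) (y ∘ i₀)) =
      -rightStar F (Q.frame i₀).quiver (Sum.elim y 0) -
        leftStar F (Q.frame i₀).quiver (Sum.elim x 0) := by
  have hX := ValuedQuiver.frame_acyclic h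
  rw [monomialChange_append]
  ext z
  rw [Pi.sub_apply, Pi.neg_apply, rightStar_apply hX, leftStar_apply hX]
  simp only [Fintype.sum_sum_type, Sum.elim_inl, Sum.elim_inr, Pi.zero_apply, mul_zero,
    Finset.sum_const_zero, add_zero]
  rcases z with i | k
  · simp only [Sum.elim_inl, ValuedQuiver.frame_arrowDim_inl_inl, Function.comp_apply,
      Equiv.apply_symm_apply]
    change _ = -(y i - ∑ j, ((Q.arrowDim j i / Q.d i : ℕ) : ℤ) * y j) -
      (x i - ∑ j, ((Q.arrowDim i j / Q.d i : ℕ) : ℤ) * x j)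
    rw [← i₀.sum_comp, ← i₀.sum_comp]
    simp only [mul_cartan_eq (F := F) hQ h, Finset.sum_neg_distrib]
    ring
  · classical
    simp only [Sum.elim_inr, ValuedQuiver.frame_arrowDim_inl_inr,
      ValuedQuiver.frame_arrowDim_inr, Function.comp_apply, Nat.zero_div, Nat.cast_zero, zero_mul,
      Finset.sum_const_zero]
    change _ = -(0 - ∑ j, (((if j = i₀ k then Q.d j else 0) / Q.d (i₀ k) : ℕ) : ℤ) * y j) - (0 - 0)
    rw [Finset.sum_eq_single (i₀ k)]
    · rw [if_pos rfl, Nat.div_self (Q.d_pos _)]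
      simp
    · intro j _ hj
      rw [if_neg hj]
      simp
    · simp

end Star

section Bichar

theorem UnitaryBichar.neg_left {L 𝕜 : Type*} [AddCommGroup L] [Field 𝕜] (χ : UnitaryBichar L 𝕜)
    (e f : L) : χ (-e) f = (χ e f)⁻¹ := by
  rw [eq_inv_iff_mul_eq_one, ← χ.add_left, neg_add_cancel, χ.zero_left]

variable [Fintype I] {𝕜 : Type*} [Field 𝕜] (v : 𝕜ˣ)

theorem d_mul_cartan_comm (hQ : Q.Acyclic) (i j : I) :
    Q.d i * cartan F Q i j = Q.d j * cartan F Q j i := by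
  classical
  rw [d_mul_cartan hQ, d_mul_cartan hQ]
  by_cases h : i = j
  · subst h; ring
  · rw [if_neg h, if_neg (Ne.symm h)]; ring

theorem seqBichar_single (hQ : Q.Acyclic) {m : ℕ} (i : Fin m → I) {a b : Fin m} (hab : a < b) :
    seqBichar F Q v i (Pi.single b 1) (Pi.single a 1) =
        v ^ (Q.d (i a) * cartan F Q (i a) (i b)) ∧
      seqBichar F Q v i (Pi.single a 1) (Pi.single b 1) =
        v ^ (-(Q.d (i a) * cartan F Q (i a) (i b))) := by
  classical
  have h : seqBichar F Q v i (Pi.single b 1) (Pi.single a 1) =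
      v ^ (Q.d (i a) * cartan F Q (i a) (i b)) := by
    refine (bicharOfTriangular_single _ hab).trans ?_
    rw [sqrtRingel, sqrtRingel, ← zpow_add, eulerExponent_simple, eulerExponent_simple,
      d_mul_cartan hQ]
    congr 1
    by_cases hij : i a = i b
    · simp only [hij, if_true]; ring
    · rw [if_neg hij, if_neg hij, if_neg (Ne.symm hij)]; ring
  refine ⟨h, ?_⟩
  rw [zpow_neg, ← h, eq_inv_iff_mul_eq_one]
  exact (seqBichar F Q v i).swap _ _

variable {n : ℕ} {i₀ : Fin n ≃ I}

theorem single_castAdd (k : Fin n) :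
    (Pi.single (Fin.castAdd n k) 1 : Fin (n + n) → ℤ) = Fin.append (Pi.single k 1) 0 := by
  ext x
  induction x using Fin.addCases with
  | left l => simp [Pi.single_apply]
  | right l =>
    have : Fin.natAdd n l ≠ Fin.castAdd n k := fun h => by
      have := congrArg Fin.val h
      simp only [Fin.val_natAdd, Fin.val_castAdd] at this
      lia
    rw [Fin.append_right, Pi.single_eq_of_ne this, Pi.zero_apply]

theorem single_natAdd (k : Fin n) :
    (Pi.single (Fin.natAdd n k) 1 : Fin (n + n) → ℤ) = Fin.append 0 (Pi.single k 1) := by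
  ext x
  induction x using Fin.addCases with
  | left l =>
    have : Fin.castAdd n l ≠ Fin.natAdd n k := fun h => by
      have := congrArg Fin.val h
      simp only [Fin.val_natAdd, Fin.val_castAdd] at this
      lia
    rw [Fin.append_left, Pi.single_eq_of_ne this, Pi.zero_apply]
  | right l =>
    rw [Fin.append_right, Pi.single_apply, Pi.single_apply]
    congr 1
    simp [Fin.ext_iff]

theorem castAdd_lt_natAdd (k l : Fin n) : Fin.castAdd n k < Fin.natAdd n l :=
  Fin.lt_def.2 (by simp only [Fin.val_natAdd, Fin.val_castAdd]; lia)

/-- Homomorphisms from `ℤ^m` to a multiplicative group are determined on the standard basis. -/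
theorem eq_of_eq_single {m : ℕ} {A : Type*} [CommGroup A] {f g : (Fin m → ℤ) → A}
    (hf : ∀ x y, f (x + y) = f x * f y) (hg : ∀ x y, g (x + y) = g x * g y)
    (h : ∀ k, f (Pi.single k 1) = g (Pi.single k 1)) (x : Fin m → ℤ) : f x = g x := by
  let Φ : (Fin m → ℤ) →+ Additive A := AddMonoidHom.mk' (fun x => Additive.ofMul (f x)) hf
  let Ψ : (Fin m → ℤ) →+ Additive A := AddMonoidHom.mk' (fun x => Additive.ofMul (g x)) hg
  have hΦ : Φ = Ψ := AddMonoidHom.functions_ext' _ _ _ fun k => AddMonoidHom.ext_int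
    (show Φ.comp (AddMonoidHom.single (fun _ => ℤ) k) 1 =
      Ψ.comp (AddMonoidHom.single (fun _ => ℤ) k) 1 from h k)
  exact DFunLike.congr_fun hΦ x

/-- The bicharacter of `ℒ_𝐢`, paired with the element `ε_l - ε_{n+l}`, reads off the coordinate at
the `l`-th vertex of the image under the monomial change. -/
theorem seqBichar_single_sub_single (hQ : Q.Acyclic) (l : Fin n) (f : Fin (n + n) → ℤ) :
    seqBichar F Q v (Fin.append i₀ i₀)
        (Pi.single (Fin.castAdd n l) 1 + -Pi.single (Fin.natAdd n l) 1) f =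
      v ^ (2 * Q.d (i₀ l) * monomialChange F Q i₀ f (.inl (i₀ l))) := by
  let χ := seqBichar F Q v (Fin.append i₀ i₀)
  refine eq_of_eq_single (f := fun f => χ _ f)
    (g := fun f => v ^ (2 * Q.d (i₀ l) * monomialChange F Q i₀ f (.inl (i₀ l))))
    (χ.add_right _) (fun f f' => ?_) (fun k => ?_) f
  · rw [← zpow_add, map_add, Pi.add_apply, mul_add]
  rw [χ.add_left, χ.neg_left, ← div_eq_mul_inv]
  have hs := fun k => d_mul_cartan_comm (F := F) hQ (i₀ k) (i₀ l)
  induction k using Fin.addCases with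
  | left k =>
    have h1 := (seqBichar_single (F := F) v hQ (Fin.append i₀ i₀) (castAdd_lt_natAdd k l)).1
    rw [h1, single_castAdd k, monomialChange_append, ← single_castAdd k]
    simp only [Fin.append_left, Fin.append_right, Sum.elim_inl, Equiv.symm_apply_apply,
      Pi.zero_apply, mul_zero, ite_self, Finset.sum_const_zero, sub_zero, Pi.single_apply, mul_ite,
      mul_one]
    rw [Finset.sum_eq_single k (by simp +contextual) (by simp)]
    rcases lt_trichotomy l k with h | h | h
    · have h2 := (seqBichar_single (F := F) v hQ (Fin.append i₀ i₀)
        (a := Fin.castAdd n l) (b := Fin.castAdd n k) h).2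
      rw [h2, div_eq_mul_inv, ← zpow_sub]
      simp only [Fin.append_left, h, h.ne, if_true, if_false]
      rw [hs]
      congr 1
      ring
    · subst h
      rw [χ.self, one_div, ← zpow_neg]
      simp only [lt_irrefl, if_true, if_false, cartan_self]
      congr 1
      ring
    · have h2 := (seqBichar_single (F := F) v hQ (Fin.append i₀ i₀)
        (a := Fin.castAdd n k) (b := Fin.castAdd n l) h).1
      rw [h2, div_eq_mul_inv, ← zpow_sub]
      simp only [Fin.append_left, h.not_gt, h.ne', if_false]
      congr 1
      ring
  | right k =>
    have h1 := (seqBichar_single (F := F) v hQ (Fin.append i₀ i₀) (castAdd_lt_natAdd l k)).2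
    rw [h1, single_natAdd k, monomialChange_append, ← single_natAdd k]
    simp only [Fin.append_left, Fin.append_right, Sum.elim_inl, Equiv.symm_apply_apply,
      Pi.zero_apply, mul_zero, ite_self, Finset.sum_const_zero, sub_zero, Pi.single_apply, mul_ite,
      mul_one]
    rw [Finset.sum_eq_single k (by simp +contextual) (by simp)]
    rcases lt_trichotomy l k with h | h | h
    · have h2 := (seqBichar_single (F := F) v hQ (Fin.append i₀ i₀)
        (a := Fin.natAdd n l) (b := Fin.natAdd n k) (Fin.natAdd_lt_natAdd_iff n |>.2 h)).2
      rw [h2, div_eq_mul_inv, ← zpow_sub]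
      simp only [Fin.append_right, h.not_gt, h.ne, if_false]
      congr 1
      ring
    · subst h
      rw [χ.self, div_one]
      simp only [lt_irrefl, if_true, if_false, cartan_self]
      congr 1
      ring
    · have h2 := (seqBichar_single (F := F) v hQ (Fin.append i₀ i₀)
        (a := Fin.natAdd n k) (b := Fin.natAdd n l) (Fin.natAdd_lt_natAdd_iff n |>.2 h)).1
      rw [h2, div_eq_mul_inv, ← zpow_sub]
      simp only [Fin.append_right, h, h.ne', if_true, if_false]
      rw [hs]
      congr 1
      ring

/-- The vectors `𝐛^j` are the images of the differences `ε_l - ε_{n+l}`. -/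
theorem bVector_frame (hQ : Q.Acyclic) (h : Q.SourceAdapted (List.ofFn i₀)) (l : Fin n) :
    bVector F (Q.frame i₀).quiver (.inl (i₀ l)) = monomialChange F Q i₀
      (Pi.single (Fin.castAdd n l) 1 + -Pi.single (Fin.natAdd n l) 1) := by
  classical
  have hX := ValuedQuiver.frame_acyclic h
  have h0 : ∀ _ : DecidableEq (I ⊕ Fin n), (Pi.single (.inl (i₀ l)) 1 : I ⊕ Fin n → ℤ) =
      Sum.elim (Pi.single (i₀ l) 1) 0 := by
    intro
    ext (i | k)
    · simp [Pi.single_apply]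
    · simp
  have h1 : (Pi.single (i₀ l) 1 : I → ℤ) ∘ i₀ = Pi.single l 1 := by
    ext k
    simp [Pi.single_apply]
  have hz : (Sum.elim (0 : I → ℤ) (0 : Fin n → ℤ)) = 0 := by ext (i | k) <;> rfl
  have hl : leftStar F (Q.frame i₀).quiver 0 = 0 := by ext; simp [leftStar]
  have hr : rightStar F (Q.frame i₀).quiver 0 = 0 := by ext; simp [rightStar]
  have h2 := monomialChange_eq_star (F := F) hQ h (Pi.single (i₀ l) 1) 0
  have h3 := monomialChange_eq_star (F := F) hQ h 0 (Pi.single (i₀ l) 1)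
  rw [hz, h1] at h2 h3
  rw [map_add, map_neg, single_castAdd, single_natAdd]
  have e0 : (0 : I → ℤ) ∘ i₀ = 0 := rfl
  rw [e0] at h2 h3
  rw [h2, h3, hl, hr, bVector, h0]
  abel

/-- Compatibility: since `𝐛^j` is the image of `ε_l - ε_{n+l}`, pairing it with `|S_i|` reads off
the `j`-th coordinate of `|S_i|`. -/
theorem isCompatible_frame (hQ : Q.Acyclic) (h : Q.SourceAdapted (List.ofFn i₀)) :
    IsCompatible F (Q.frame i₀).quiver v (Set.range Sum.inl)
      ((seqBichar F Q v (Fin.append i₀ i₀)).map (monomialChange F Q i₀)) := by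
  let _ : DecidableEq (I ⊕ Fin n) := fun a b => Classical.propDecidable (a = b)
  rintro _ ⟨j, rfl⟩ i
  obtain ⟨l, rfl⟩ := i₀.surjective j
  rw [bVector_frame hQ h]
  change seqBichar F Q v (Fin.append i₀ i₀) ((monomialChange F Q i₀).symm (monomialChange F Q i₀ _))
    ((monomialChange F Q i₀).symm _) = _
  rw [AddEquiv.symm_apply_apply, seqBichar_single_sub_single v hQ, AddEquiv.apply_symm_apply,
    log_natCard_end (ValuedQuiver.frame_acyclic h)]
  split_ifs with hi
  · subst hi
    rw [Pi.single_eq_same, mul_one]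
    exact zpow_natCast v (2 * Q.d (i₀ l))
  · rw [Pi.single_eq_of_ne (Ne.symm hi), mul_zero, zpow_zero]

end Bichar

/-! ### Flags of type `(𝐢₀, 𝐢₀)` -/

namespace Rep

/-- The equivalences at the vertices given by an isomorphism of representations. -/
def isoApp {V W : Rep F Q} (e : V ≅ W) (i : I) : V.V i ≃ₗ[VertexField F Q i] W.V i :=
  LinearEquiv.ofLinearMap (e.hom.app i) (e.inv.app i)
    (congrArg (fun f : W ⟶ W => f.app i) e.inv_hom_id)
    (congrArg (fun f : V ⟶ V => f.app i) e.hom_inv_id)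

open Classical in
theorem finrank_pow_simple (j : I) (a : ℕ) (i : I) :
    Module.finrank (VertexField F Q i) (((simple F Q j).pow a).V i) = if i = j then a else 0 := by
  change Module.finrank (VertexField F Q i) (Fin a → (simple F Q j).V i) = _
  rw [Module.finrank_pi_fintype, Finset.sum_const, finrank_simple]
  simp

open Classical in
theorem nonempty_iso_pow_simple_iff (hQ : Q.Acyclic) (R : Rep F Q) (j : I) (a : ℕ) :
    Nonempty (R ≅ (simple F Q j).pow a) ↔
      ∀ i, Module.finrank (VertexField F Q i) (R.V i) = if i = j then a else 0 := by
  constructor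
  · rintro ⟨e⟩ i
    rw [(isoApp e i).finrank_eq, finrank_pow_simple]
  · intro h
    have e : ∀ i, R.V i ≃ₗ[VertexField F Q i] ((simple F Q j).pow a).V i := fun i =>
      LinearEquiv.ofFinrankEq _ _ ((h i).trans (finrank_pow_simple j a i).symm)
    have hsub : ∀ i, i ≠ j → Subsingleton (R.V i) := fun i hi =>
      Module.finrank_zero_iff.1 ((h i).trans (if_neg hi))
    -- there are no loops, so one end of every arrow carries the zero space
    have hmap : ∀ α x, R.map α x = 0 := fun α x => by
      by_cases hs : Q.s α = j
      · have ht : Q.t α ≠ j := fun ht => hQ j (.single ⟨α, hs, ht⟩)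
        have := hsub _ ht
        exact Subsingleton.elim _ _
      · have := hsub _ hs
        rw [Subsingleton.elim x 0, map_zero]
    have hmap' : ∀ α y, ((simple F Q j).pow a).map α y = 0 := fun α y => rfl
    exact ⟨⟨⟨fun i => (e i).toLinearMap, fun α x => by
        rw [hmap', hmap]; exact (map_zero (e _)).symm⟩,
      ⟨fun i => (e i).symm.toLinearMap, fun α x => by
        rw [hmap', hmap]; exact (map_zero (e _).symm).symm⟩,
      by ext i x; exact (e i).symm_apply_apply x,
      by ext i x; exact (e i).apply_symm_apply x⟩⟩

end Rep

namespace SubRep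

variable {V : Rep F Q}

instance [Finite I] : Finite (SubRep V) :=
  Finite.of_injective (fun E => E.carrier) fun _ _ h => SubRep.ext h

theorem finrank_quotient_restrict {E E' : SubRep V} (h : E ≤ E') (i : I) :
    Module.finrank (VertexField F Q i) ((E.restrict E').quotient.V i) +
        Module.finrank (VertexField F Q i) (E.carrier i) =
      Module.finrank (VertexField F Q i) (E'.carrier i) := by
  have h1 := Submodule.finrank_quotient_add_finrank ((E.carrier i).comap (E'.carrier i).subtype)
  rw [(Submodule.comapSubtypeEquivOfLe (h i)).finrank_eq] at h1
  exact h1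

open Classical in
/-- The condition on a step of a flag, in terms of dimensions. -/
theorem step_iff (hQ : Q.Acyclic) {E E' : SubRep V} (h : E ≤ E') (j : I) (a : ℕ) :
    Nonempty ((E.restrict E').quotient ≅ (simple F Q j).pow a) ↔
      ∀ i, Module.finrank (VertexField F Q i) (E'.carrier i) =
        Module.finrank (VertexField F Q i) (E.carrier i) + if i = j then a else 0 := by
  rw [Rep.nonempty_iso_pow_simple_iff hQ]
  refine forall_congr' fun i => ?_
  have := finrank_quotient_restrict h i
  lia

variable {n : ℕ} {i₀ : Fin n ≃ I} (hi₀ : Q.SourceAdapted (List.ofFn i₀))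

/-- The flag of type `(𝐢₀, 𝐢₀)` through a subobject `E`: first the vertices of `V / E` are removed,
in the given order, and then those of `E`. -/
def flag (E : SubRep V) (k : ℕ) : SubRep V where
  carrier i := if k ≤ i₀.symm i then ⊤ else if k ≤ n + i₀.symm i then E.carrier i else ⊥
  stable α x hx := by
    have h := Fin.lt_def.1 (hi₀.lt α)
    by_cases h1 : k ≤ i₀.symm (Q.s α)
    · rw [if_pos (h1.trans h.le)]
      trivial
    · rw [if_neg h1] at hx
      by_cases h2 : k ≤ n + i₀.symm (Q.s α)
      · rw [if_pos h2] at hx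
        rw [if_pos (h2.trans (by lia) : k ≤ n + i₀.symm (Q.t α))]
        split_ifs
        · trivial
        · exact E.stable α x hx
      · rw [if_neg h2] at hx
        rw [(Submodule.mem_bot _).1 hx, map_zero]
        exact zero_mem _

theorem flag_carrier (E : SubRep V) (k : ℕ) (i : I) : (flag hi₀ E k).carrier i =
    if k ≤ i₀.symm i then ⊤ else if k ≤ n + i₀.symm i then E.carrier i else ⊥ := rfl

theorem flag_zero (E : SubRep V) : flag hi₀ E 0 = ⊤ :=
  SubRep.ext (funext fun i => by
    rw [flag_carrier, if_pos (Nat.zero_le _)]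
    rfl)

theorem flag_self (E : SubRep V) : flag hi₀ E n = E :=
  SubRep.ext (funext fun i => (if_neg (by have := (i₀.symm i).2; lia)).trans (if_pos (by lia)))

theorem flag_last (E : SubRep V) : flag hi₀ E (n + n) = ⊥ :=
  SubRep.ext (funext fun i => by
    have := (i₀.symm i).2
    exact (if_neg (by lia)).trans (if_neg (by lia)))

theorem flag_succ_le (E : SubRep V) (k : ℕ) : flag hi₀ E (k + 1) ≤ flag hi₀ E k := by
  intro i
  rw [flag_carrier, flag_carrier]
  by_cases h1 : k + 1 ≤ i₀.symm i
  · rw [if_pos h1, if_pos (by lia)]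
  · rw [if_neg h1]
    by_cases h2 : k + 1 ≤ n + i₀.symm i
    · rw [if_pos h2, if_pos (by lia : k ≤ n + i₀.symm i)]
      split_ifs
      · exact le_top
      · exact le_rfl
    · rw [if_neg h2]
      exact bot_le

theorem flag_succ_eq (E : SubRep V) {k : ℕ} {i : I} (h1 : k ≠ i₀.symm i)
    (h2 : k ≠ n + i₀.symm i) : (flag hi₀ E (k + 1)).carrier i = (flag hi₀ E k).carrier i := by
  have e1 : k + 1 ≤ i₀.symm i ↔ k ≤ i₀.symm i := by lia
  have e2 : k + 1 ≤ n + i₀.symm i ↔ k ≤ n + i₀.symm i := by lia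
  rw [flag_carrier, flag_carrier]
  simp only [e1, e2]

/-- The type of the flag through `E`: the dimensions of `V / E` and of `E` at the vertices in the
given order. -/
def flagType (i₀ : Fin n ≃ I) (E : SubRep V) : Fin (n + n) → ℕ :=
  Fin.append (fun p => Module.finrank (VertexField F Q (i₀ p)) (E.quotient.V (i₀ p)))
    (fun p => Module.finrank (VertexField F Q (i₀ p)) (E.carrier (i₀ p)))

theorem finrank_quotient_V (E : SubRep V) (i : I) :
    Module.finrank (VertexField F Q i) (E.quotient.V i) +
      Module.finrank (VertexField F Q i) (E.carrier i) =
      Module.finrank (VertexField F Q i) (V.V i) :=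
  Submodule.finrank_quotient_add_finrank (E.carrier i)

open Classical in
theorem finrank_flag (E : SubRep V) (k : Fin (n + n)) (i : I) :
    Module.finrank (VertexField F Q i) ((flag hi₀ E k).carrier i) =
      Module.finrank (VertexField F Q i) ((flag hi₀ E (k + 1)).carrier i) +
        if i = Fin.append i₀ i₀ k then flagType i₀ E k else 0 := by
  have hi := (i₀.symm i).2
  induction k using Fin.addCases with
  | left p =>
    have hp := p.2
    rw [Fin.append_left, Fin.val_castAdd]
    split_ifs with h
    · subst h
      rw [flag_carrier, flag_carrier, Equiv.symm_apply_apply, if_pos le_rfl,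
        if_neg (by lia), if_pos (by lia), finrank_top, flagType, Fin.append_left,
        ← finrank_quotient_V E, add_comm]
    · have h1 : (p : ℕ) ≠ i₀.symm i := fun h' => h (by rw [Fin.ext h', Equiv.apply_symm_apply])
      rw [flag_succ_eq hi₀ E h1 (by lia), add_zero]
  | right p =>
    rw [Fin.append_right, Fin.val_natAdd]
    split_ifs with h
    · subst h
      have hp := p.2
      rw [flag_carrier, flag_carrier, Equiv.symm_apply_apply, if_neg (by lia), if_pos le_rfl,
        if_neg (by lia), if_neg (by lia), finrank_bot, zero_add, flagType, Fin.append_right]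
    · have h1 : (p : ℕ) ≠ i₀.symm i := fun h' => h (by rw [Fin.ext h', Equiv.apply_symm_apply])
      rw [flag_succ_eq hi₀ E (by lia) (by lia), add_zero]

theorem eq_of_forall_succ_eq {m : ℕ} {X : Type*} {f : Fin (m + 1) → X} {a b : ℕ}
    (h : ∀ k : Fin m, a ≤ k → (k : ℕ) < b → f k.succ = f k.castSucc) {x y : Fin (m + 1)}
    (hax : a ≤ x) (hxy : x ≤ y) (hyb : y ≤ b) : f x = f y := by
  induction y using Fin.induction with
  | zero => rw [Fin.le_zero_iff.1 hxy]
  | succ k ih =>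
    rcases hxy.eq_or_lt with e | hlt
    · rw [e]
    · have hxk : x ≤ k.castSucc := Fin.le_castSucc_iff.2 hlt
      have hk : (x : ℕ) ≤ k := Fin.le_def.1 hxk
      rw [Fin.val_succ] at hyb
      rw [ih hxk (by rw [Fin.val_castSucc]; lia), h k (hax.trans hk) (by lia)]

/-- Every flag of type `(𝐢₀, 𝐢₀)` is determined by its middle term. -/
theorem eq_flag (hQ : Q.Acyclic) {W : Fin (n + n + 1) → SubRep V} {a : Fin (n + n) → ℕ}
    (h0 : W 0 = ⊤) (hl : W (Fin.last _) = ⊥)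
    (hW : ∀ k : Fin (n + n), W k.succ ≤ W k.castSucc ∧
      Nonempty (((W k.succ).restrict (W k.castSucc)).quotient ≅
        (simple F Q (Fin.append i₀ i₀ k)).pow (a k))) (k : Fin (n + n + 1)) :
    W k = flag hi₀ (W ⟨n, by lia⟩) k := by
  classical
  refine SubRep.ext (funext fun i => ?_)
  have hi := (i₀.symm i).2
  have hk := k.2
  have hstep : ∀ k : Fin (n + n), (k : ℕ) ≠ i₀.symm i → (k : ℕ) ≠ n + i₀.symm i →
      (W k.succ).carrier i = (W k.castSucc).carrier i := fun k h1 h2 => by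
    have h3 := (step_iff hQ (hW k).1 _ _).1 (hW k).2 i
    refine Submodule.eq_of_le_of_finrank_eq ((hW k).1 i) ?_
    rw [h3, if_neg, add_zero]
    intro h
    induction k using Fin.addCases with
    | left p =>
      rw [Fin.append_left] at h
      rw [h, Equiv.symm_apply_apply] at h1
      exact h1 rfl
    | right p =>
      rw [Fin.append_right] at h
      rw [h, Equiv.symm_apply_apply] at h2
      exact h2 rfl
  rw [flag_carrier]
  by_cases h1 : (k : ℕ) ≤ i₀.symm i
  · rw [if_pos h1, ← eq_of_forall_succ_eq (f := fun k => (W k).carrier i) (a := 0)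
      (b := i₀.symm i) (x := 0) (fun k _ hk => hstep k (by lia) (by lia)) (Nat.zero_le _)
      (Fin.zero_le k) h1, h0]
    rfl
  · rw [if_neg h1]
    by_cases h2 : (k : ℕ) ≤ n + i₀.symm i
    · rw [if_pos h2]
      have h3 := @eq_of_forall_succ_eq _ _ (fun k => (W k).carrier i) (i₀.symm i + 1)
        (n + i₀.symm i) (fun k h4 h5 => hstep k (by lia) (by lia))
      rcases le_total (k : ℕ) n with h4 | h4
      · exact h3 (x := k) (y := ⟨n, by lia⟩) (by lia) (Fin.le_def.2 h4) (by simp)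
      · exact (h3 (x := ⟨n, by lia⟩) (y := k) (show (i₀.symm i : ℕ) + 1 ≤ n from hi)
          (Fin.le_def.2 h4) h2).symm
    · rw [if_neg h2, eq_of_forall_succ_eq (f := fun k => (W k).carrier i)
        (a := n + i₀.symm i + 1) (b := n + n) (y := Fin.last _)
        (fun k h3 _ => hstep k (by lia) (by lia)) (by lia) (Fin.le_last k) le_rfl, hl]
      rfl

/-- Flags of type `(𝐢₀, 𝐢₀)` correspond to subobjects. -/
theorem natCard_flags (hi₀ : Q.SourceAdapted (List.ofFn i₀)) (hQ : Q.Acyclic)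
    (V : Rep F Q) (a : Fin (n + n) → ℕ) :
    Nat.card (Flags (Fin.append i₀ i₀) a V) =
      Nat.card {E : SubRep V // flagType i₀ E = a} := by
  classical
  refine Nat.card_congr
    { toFun := fun W => ⟨W.1 ⟨n, by lia⟩, ?_⟩
      invFun := fun E => ⟨fun k => flag hi₀ E.1 k, flag_zero hi₀ E.1, flag_last hi₀ E.1, ?_⟩
      left_inv := fun W => Subtype.ext (funext fun k =>
        (eq_flag hi₀ hQ W.2.1 W.2.2.1 W.2.2.2 k).symm)
      right_inv := fun E => Subtype.ext (flag_self hi₀ E.1) }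
  · ext k
    have h1 := (step_iff hQ (W.2.2.2 k).1 _ _).1 (W.2.2.2 k).2 (Fin.append i₀ i₀ k)
    have h2 := finrank_flag hi₀ (W.1 ⟨n, by lia⟩) k (Fin.append i₀ i₀ k)
    have e1 := eq_flag hi₀ hQ W.2.1 W.2.2.1 W.2.2.2 k.castSucc
    have e2 := eq_flag hi₀ hQ W.2.1 W.2.2.1 W.2.2.2 k.succ
    rw [Fin.val_castSucc] at e1
    rw [Fin.val_succ] at e2
    rw [← e1, ← e2, h1, if_pos rfl, if_pos rfl] at h2
    lia
  · intro k
    have h : flag hi₀ E.1 (k.succ : ℕ) ≤ flag hi₀ E.1 (k.castSucc : ℕ) := flag_succ_le hi₀ E.1 k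
    refine ⟨h, (step_iff hQ h _ _).2 fun i => ?_⟩
    have := finrank_flag hi₀ E.1 k i
    rwa [E.2] at this

end SubRep

/-! ### The coefficients of the `𝐢`-character -/

/-- A sum over the values of `f`, weighted by the sizes of the fibres, is a sum over the source. -/
theorem finsum_natCard_fiber {A B M : Type*} [Finite A] [AddCommMonoid M] (f : A → B) (g : B → M) :
    ∑ᶠ b, Nat.card {x // f x = b} • g b = ∑ᶠ x, g (f x) := by
  classical
  have := Fintype.ofFinite A
  rw [finsum_eq_sum_of_fintype (fun x => g (f x)), Finset.sum_comp g f,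
    finsum_eq_sum_of_support_subset (s := Finset.univ.image f)]
  · refine Finset.sum_congr rfl fun b _ => ?_
    rw [Nat.card_eq_fintype_card, Fintype.card_subtype]
  · intro b hb
    by_contra h
    refine hb ?_
    have : IsEmpty {x // f x = b} := ⟨fun x => h (Finset.mem_coe.2
      (Finset.mem_image.2 ⟨x.1, Finset.mem_univ _, x.2⟩))⟩
    change Nat.card {x // f x = b} • g b = 0
    rw [Nat.card_of_isEmpty, zero_smul]

section Torus

variable {L 𝕜 : Type*} [AddCommGroup L] [Field 𝕜] (χ : UnitaryBichar L 𝕜)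

theorem UnitaryBichar.sum_right {ι : Type*} (s : Finset ι) (e : L) (f : ι → L) :
    χ e (∑ k ∈ s, f k) = ∏ k ∈ s, χ e (f k) := by
  classical
  induction s using Finset.induction_on with
  | empty => exact χ.zero_right e
  | insert k s hk ih => rw [Finset.sum_insert hk, Finset.prod_insert hk, χ.add_right, ih]

theorem UnitaryBichar.nsmul_nsmul (e f : L) (a b : ℕ) : χ (a • e) (b • f) = χ e f ^ (a * b) := by
  have h1 : ∀ f, χ (a • e) f = χ e f ^ a := fun f => by
    induction a with
    | zero => rw [zero_smul, χ.zero_left, pow_zero]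
    | succ a ih => rw [succ_nsmul, χ.add_left, ih, pow_succ]
  have h2 : χ e (b • f) = χ e f ^ b := by
    induction b with
    | zero => rw [zero_smul, χ.zero_right, pow_zero]
    | succ b ih => rw [succ_nsmul, χ.add_right, ih, pow_succ]
  rw [h1, h2, ← pow_mul, mul_comm]

namespace QTorus

theorem X_pow (e : L) (a : ℕ) : X χ e ^ a = X χ (a • e) := by
  induction a with
  | zero => rw [pow_zero, zero_smul, one_def]
  | succ a ih =>
    have h : χ (a • e) e = 1 := by
      have := χ.nsmul_nsmul e e a 1
      rwa [one_smul, χ.self, one_pow] at this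
    rw [pow_succ, ih, X_mul_X, h, Units.val_one, one_smul, succ_nsmul]

/-- The ordered product of basis vectors of a based quantum torus. -/
theorem prod_ofFn_X : ∀ {m : ℕ} (f : Fin m → L), (List.ofFn fun k => X χ (f k)).prod =
    ((∏ k, ∏ l ∈ Finset.Ioi k, χ (f k) (f l) : 𝕜ˣ) : 𝕜) • X χ (∑ k, f k)
  | 0, f => by
    rw [Fin.prod_univ_zero, Fin.sum_univ_zero, Units.val_one, one_smul, List.ofFn_zero,
      List.prod_nil, one_def]
  | m + 1, f => by
    rw [List.ofFn_succ, List.prod_cons, prod_ofFn_X (fun k => f k.succ), mul_smul', X_mul_X,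
      smul_smul, Fin.prod_univ_succ, Fin.sum_univ_succ, UnitaryBichar.sum_right,
      Fin.prod_Ioi_zero, ← Units.val_mul, mul_comm]
    simp only [Fin.prod_Ioi_succ]

end QTorus

end Torus

section Coefficient

variable {𝕜 : Type*} [Field 𝕜] (v : 𝕜ˣ)

theorem prod_gen_pow {m : ℕ} (i : Fin m → I) (a : Fin m → ℕ) :
    (List.ofFn fun k => gen F Q v i k ^ a k).prod =
      ((∏ k, ∏ l ∈ Finset.Ioi k, (seqBichar F Q v i) (Pi.single k 1) (Pi.single l 1) ^ (a k * a l) :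
        𝕜ˣ) : 𝕜) • QTorus.X (seqBichar F Q v i) (fun k => a k) := by
  simp only [gen, QTorus.X_pow]
  rw [QTorus.prod_ofFn_X]
  simp only [UnitaryBichar.nsmul_nsmul]
  congr 2
  ext l
  simp [Finset.sum_apply, Pi.single_apply]

theorem eulerForm_eq_sum [Fintype I] (F : Type u) [Field F] [Finite F] (x y : I → ℤ) :
    eulerForm Q x y =
      ∑ i, ∑ j, eulerExponent (simple F Q i) (simple F Q j) * (x i * y j) := by
  classical
  simp only [eulerExponent_simple, sub_mul, Finset.sum_sub_distrib, eulerForm, ite_mul, zero_mul]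
  simp

/-- For every summand of the `𝐢`-character, the ordering of the generators contributes half of the
exponents of the commutation relations, which turns the antisymmetrized Euler form of the simples
into the Euler form itself. -/
theorem coeff_mul_prod_gen_pow {m : ℕ} (i : Fin m → I) (a : Fin m → ℕ) :
    ((∏ k, ∏ l ∈ Finset.Ioi k,
        (sqrtRingel v (simple F Q (i k)) (simple F Q (i l)) /
          sqrtRingel v (simple F Q (i l)) (simple F Q (i k))) ^ (a k * a l) : 𝕜ˣ) : 𝕜) •
      (List.ofFn fun k => gen F Q v i k ^ a k).prod =
    ((∏ k, ∏ l ∈ Finset.Ioi k, v ^ (-(2 * (eulerExponent (simple F Q (i l)) (simple F Q (i k)) *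
        (a l * a k)))) : 𝕜ˣ) : 𝕜) • QTorus.X (seqBichar F Q v i) (fun k => a k) := by
  rw [prod_gen_pow, smul_smul, ← Units.val_mul]
  congr 2
  simp only [← Finset.prod_mul_distrib]
  refine Finset.prod_congr rfl fun k _ => Finset.prod_congr rfl fun l hl => ?_
  have h : seqBichar F Q v i (Pi.single k 1) (Pi.single l 1) =
      (sqrtRingel v (simple F Q (i k)) (simple F Q (i l)) *
        sqrtRingel v (simple F Q (i l)) (simple F Q (i k)))⁻¹ := by
    rw [← bicharOfTriangular_single (fun k l =>
      sqrtRingel v (simple F Q (i k)) (simple F Q (i l)) *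
      sqrtRingel v (simple F Q (i l)) (simple F Q (i k))) (Finset.mem_Ioi.1 hl),
      eq_inv_iff_mul_eq_one]
    exact (seqBichar F Q v i).swap _ _
  rw [h, ← mul_pow, sqrtRingel, sqrtRingel, div_eq_mul_inv, ← zpow_add, ← zpow_neg, ← zpow_neg,
    ← zpow_add, ← zpow_add, ← zpow_natCast, ← zpow_mul]
  congr 1
  push_cast
  ring

variable {n : ℕ} {i₀ : Fin n ≃ I}

/-- Among the simples of type `(𝐢₀, 𝐢₀)` in the given order, `⟨S_{i_l}, S_{i_k}⟩` for `k < l` is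
trivial unless `k` belongs to the first and `l` to the second copy of `𝐢₀`. -/
theorem prod_eulerExponent_append [Fintype I] (h : Q.SourceAdapted (List.ofFn i₀)) (x y : I → ℤ)
    (a : Fin (n + n) → ℤ) (ha : a = Fin.append (x ∘ i₀) (y ∘ i₀)) :
    ∏ k, ∏ l ∈ Finset.Ioi k, v ^ (-(2 * (eulerExponent (simple F Q (Fin.append i₀ i₀ l))
      (simple F Q (Fin.append i₀ i₀ k)) * (a l * a k)))) = v ^ (-(2 * eulerForm Q y x)) := by
  have h0 : ∀ p q : Fin n, p < q →
      eulerExponent (simple F Q (i₀ q)) (simple F Q (i₀ p)) = 0 := fun p q hpq => by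
    classical
    rw [eulerExponent_simple, if_neg (fun h => hpq.ne' (i₀.injective h)),
      arrowDim_eq_zero_of_le h (by simpa using hpq.le)]
    simp
  have hsum : ∀ {ι : Type} [Fintype ι] (f : ι → ℤ), v ^ (∑ k, f k) = ∏ k, v ^ f k :=
    fun f => map_sum (AddMonoidHom.mk' (fun z : ℤ => Additive.ofMul (v ^ z)) (zpow_add v)) f _
  simp only [← Finset.filter_lt_eq_Ioi, Finset.prod_filter]
  subst ha
  rw [Fin.prod_univ_add]
  simp only [Fin.prod_univ_add, Fin.append_left, Fin.append_right, castAdd_lt_natAdd,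
    (castAdd_lt_natAdd _ _).not_gt, if_true, if_false, Finset.prod_const_one, one_mul]
  have e1 : ∀ (p q : Fin n) (z : ℤ) (P : Prop) [Decidable P] , (P → p < q) →
      (if P then v ^ (-(2 * (eulerExponent (simple F Q (i₀ q)) (simple F Q (i₀ p)) * z)))
        else 1) = 1 := fun p q z P _ hP => by
    split_ifs with h
    · rw [h0 p q (hP h), zero_mul, mul_zero, neg_zero, zpow_zero]
    · rfl
  have e2 := fun (p q : Fin n) z => e1 p q z (Fin.castAdd n p < Fin.castAdd n q) id
  have e3 := fun (p q : Fin n) z => e1 p q z _ (Fin.natAdd_lt_natAdd_iff n).1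
  simp only [e2, e3, Finset.prod_const_one, one_mul, mul_one]
  rw [eulerForm_eq_sum F, Finset.mul_sum, ← Finset.sum_neg_distrib, hsum, ← i₀.prod_comp]
  rw [Finset.prod_comm]
  refine Finset.prod_congr rfl fun q _ => ?_
  rw [Finset.mul_sum, ← Finset.sum_neg_distrib, hsum, ← i₀.prod_comp]
  rfl

end Coefficient

section Frame

/-! ### Subobjects of a representation that vanishes at the new vertices -/

section ExtendByZero

variable {J : Type} (X : Q.Extension J) {V : Rep F Q}

namespace SubRep

/-- A subobject of `V`, viewed as a subobject of the extension of `V` by zero. -/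
def extendByZero (E : SubRep V) : SubRep (V.extendByZero X) where
  carrier
    | .inl i => E.carrier i
    | .inr _ => ⊥
  stable
    | .inl α => E.stable α
    | .inr _ => fun _ _ => zero_mem _

instance (j : J) : Subsingleton ((V.extendByZero X).V (.inr j)) :=
  inferInstanceAs (Subsingleton PUnit)

/-- Extension by zero does not change the subobjects. -/
def extendByZeroEquiv : SubRep V ≃ SubRep (V.extendByZero X) where
  toFun E := E.extendByZero X
  invFun E := ⟨fun i => E.carrier (.inl i), fun α => E.stable (.inl α)⟩
  left_inv _ := rfl
  right_inv _ := SubRep.ext (funext fun i => match i with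
    | .inl _ => rfl
    | .inr j => Subsingleton.elim (α := Submodule (VertexField F X.quiver (.inr j))
        ((V.extendByZero X).V (.inr j))) _ _)

theorem dim_extendByZero_toRep (E : SubRep V) :
    (E.extendByZero X).toRep.dim = Sum.elim E.toRep.dim 0 := by
  ext (i | j)
  · rfl
  · have : Subsingleton ((E.extendByZero X).toRep.V (.inr j)) :=
      inferInstanceAs (Subsingleton ((E.extendByZero X).carrier (.inr j)))
    exact congrArg Nat.cast (Module.finrank_zero_of_subsingleton)

theorem dim_extendByZero_quotient (E : SubRep V) :
    (E.extendByZero X).quotient.dim = Sum.elim E.quotient.dim 0 := by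
  ext (i | j)
  · rfl
  · have : Subsingleton ((E.extendByZero X).quotient.V (.inr j)) :=
      inferInstanceAs (Subsingleton (_ ⧸ (E.extendByZero X).carrier (.inr j)))
    exact congrArg Nat.cast (Module.finrank_zero_of_subsingleton)

end SubRep

end ExtendByZero

variable [Fintype I] {n : ℕ} {i₀ : Fin n ≃ I}

theorem eulerForm_frame (x y : I → ℤ) :
    eulerForm (Q.frame i₀).quiver (Sum.elim x 0) (Sum.elim y 0) = eulerForm Q x y := by
  simp only [eulerForm, Fintype.sum_sum_type, Sum.elim_inl, Sum.elim_inr, Pi.zero_apply, mul_zero,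
    zero_mul, Finset.sum_const_zero, add_zero, ValuedQuiver.frame_arrowDim_inl_inl]
  rfl

/-! ### The two characters as sums over subobjects -/

section Main

variable {𝕜 : Type*} [Field 𝕜] (v : 𝕜ˣ)

/-- The quantum cluster character over the framed quiver, as a sum over the subobjects of `V`. -/
theorem clusterCharacter_extendByZero (hQ : Q.Acyclic)
    (h : Q.SourceAdapted (List.ofFn i₀)) (χ : UnitaryBichar (I ⊕ Fin n → ℤ) 𝕜) (V : Rep F Q) :
    clusterCharacter v χ (V.extendByZero (Q.frame i₀)) =
      ∑ᶠ E : SubRep V, ((v ^ (-(2 * eulerForm Q E.toRep.dim E.quotient.dim)) : 𝕜ˣ) : 𝕜) •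
        QTorus.X χ (monomialChange F Q i₀
          (Fin.append (E.quotient.dim ∘ i₀) (E.toRep.dim ∘ i₀))) := by
  rw [clusterCharacter, ← finsum_comp_equiv (SubRep.extendByZeroEquiv (Q.frame i₀))]
  refine finsum_congr fun E => ?_
  change (((ringel v (E.extendByZero _).toRep (E.extendByZero _).quotient)⁻¹ : 𝕜ˣ) : 𝕜) •
    QTorus.X χ (- rightStar F _ (E.extendByZero _).toRep.dim -
      leftStar F _ (E.extendByZero _).quotient.dim) = _
  rw [monomialChange_eq_star hQ h, ringel, eulerExponent_eq, SubRep.dim_extendByZero_toRep,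
    SubRep.dim_extendByZero_quotient, eulerForm_frame, zpow_neg]

/-- The `𝐢`-character for `𝐢 = (𝐢₀, 𝐢₀)`, as a sum over the subobjects of `V`. -/
theorem iCharacter_append (hQ : Q.Acyclic) (h : Q.SourceAdapted (List.ofFn i₀)) (V : Rep F Q) :
    iCharacter v (Fin.append i₀ i₀) V =
      ∑ᶠ E : SubRep V, ((v ^ (-(2 * eulerForm Q E.toRep.dim E.quotient.dim)) : 𝕜ˣ) : 𝕜) •
        QTorus.X (seqBichar F Q v (Fin.append i₀ i₀))
          (Fin.append (E.quotient.dim ∘ i₀) (E.toRep.dim ∘ i₀)) := by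
  have ha : ∀ E : SubRep V, (fun k => (SubRep.flagType i₀ E k : ℤ)) =
      Fin.append (E.quotient.dim ∘ i₀) (E.toRep.dim ∘ i₀) := fun E => by
    ext k
    induction k using Fin.addCases with
    | left p => rw [Fin.append_left, SubRep.flagType, Fin.append_left]; rfl
    | right p => rw [Fin.append_right, SubRep.flagType, Fin.append_right]; rfl
  rw [iCharacter]
  simp only [SubRep.natCard_flags h hQ, mul_comm _ ((Nat.card _ : ℕ) : 𝕜), mul_smul,
    coeff_mul_prod_gen_pow, Nat.cast_smul_eq_nsmul]
  rw [finsum_natCard_fiber (SubRep.flagType i₀) (fun a => _ • QTorus.X _ (fun k => (a k : ℤ)))]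
  refine finsum_congr fun E => ?_
  rw [prod_eulerExponent_append v h _ _ (fun k => (SubRep.flagType i₀ E k : ℤ)) (ha E), ha E]

end Main

end Frame

end QuantumCharacter

end

theorem mainTheorem3 {I : Type} [Fintype I] (Q : QuantumCharacter.ValuedQuiver I)
    (hQ : Q.Acyclic) {n : ℕ} (i₀ : Fin n ≃ I) (hi₀ : Q.SourceAdapted (List.ofFn i₀)) :
    ∃ X : Q.Extension (Fin n), X.quiver.Acyclic ∧
      ∀ (F : Type u) [Field F] [Finite F] (𝕜 : Type w) [Field 𝕜] [CharZero 𝕜] (v : 𝕜ˣ),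
        (v : 𝕜) ^ 4 = (Nat.card F : 𝕜) →
        QuantumCharacter.IsCompatible F X.quiver v (Set.range Sum.inl)
          ((QuantumCharacter.seqBichar F Q v (Fin.append i₀ i₀)).map
            (QuantumCharacter.monomialChange F Q i₀)) ∧
        ∀ V : QuantumCharacter.Rep F Q,
          QuantumCharacter.QTorus.mapEquiv (QuantumCharacter.seqBichar F Q v (Fin.append i₀ i₀))
              (QuantumCharacter.monomialChange F Q i₀)
              (QuantumCharacter.iCharacter v (Fin.append i₀ i₀) V) =
            QuantumCharacter.clusterCharacter v
              ((QuantumCharacter.seqBichar F Q v (Fin.append i₀ i₀)).map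
                (QuantumCharacter.monomialChange F Q i₀))
              (V.extendByZero X) := by
  refine ⟨Q.frame i₀, QuantumCharacter.ValuedQuiver.frame_acyclic hi₀, ?_⟩
  intro F _ _ 𝕜 _ _ v _
  refine ⟨QuantumCharacter.isCompatible_frame v hQ hi₀, fun V => ?_⟩
  have := Fintype.ofFinite (QuantumCharacter.SubRep V)
  rw [QuantumCharacter.iCharacter_append v hQ hi₀,
    QuantumCharacter.clusterCharacter_extendByZero v hQ hi₀, finsum_eq_sum_of_fintype,
    finsum_eq_sum_of_fintype, map_sum]
  refine Finset.sum_congr rfl fun E _ => ?_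
  rw [map_smul, QuantumCharacter.QTorus.mapEquiv_X]
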